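/- **Theorem (Finite-sample Bayesian interpretation).** *Setting.* Let $\mathcal C$ and $\mathcal X\neq\emptyset$ be standard Borel spaces (for instance Borel subsets of $\mathbb R^{d_C}$ and $\mathbb R^{d_X}$), let $n\ge 2$, and let $\Delta(\cdot)$ denote the set of Borel probability measures, with the $\sigma$-algebra generated by the evaluations $P\mapsto P(A)$. Let $h=h_t:\mathcal C^2\to\mathcal X$ be a random function, indexed by a point $t$ of a probability space with law $\pi$, such that $(t,c,c')\mapsto h_t(c,c')$ is measurable; $\pi(h)$ denotes its law. Let $Q\in\Delta(\mathcal C)$. For $\alpha>0$ let $DP(Q,\alpha)$ be the Dirichlet process, i.e. the law of a random $P\in\Delta(\mathcal C)$ with $(P(A_1),\dots,P(A_R))\sim\mathrm{Dir}(\alpha Q(A_1),\dots,\alpha Q(A_R))$ for every finite measurable partition $A_1,\dots,A_R$ of $\mathcal C$ (a coordinate with parameter $0$ is $0$). *Model and prior.* For each $\alpha>0$ let $(h,\mathbb P_C)\sim\pi(h)\cdot DP(Q,\alpha)$, let $C_1,\dots,C_n\mid h,\mathbb P_C$ be i.i.d. from $\mathbb P_C$, and put $X_{k\ell}=h(C_k,C_\ell)$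 whenever $C_k\neq C_\ell$. The dyadic data $\{X_{k\ell}\}_{k\ne\ell}$ are thus observed in full exactly when $C_1,\dots,C_n$ are pairwise distinct, and all laws below are conditional on this event. (If this event is null, as can happen only when $Q$ has atoms, nothing is claimed.) Let $\mathbb P_{X_{ij}}$ be the law of $h(C,C')$ given $C\neq C'$, where $C,C'$ are independent with law $\mathbb P_C$. Let $\theta=T(\mathbb P_{X_{ij}})$ for a measurable $T:\Delta(\mathcal X)\to\mathbb R$. Let $\pi_\alpha(\theta\mid x)$ be the posterior, i.e. a regular conditional distribution of $\theta$ given $\{X_{k\ell}\}_{k\neq\ell}=x$. *Bayesian bootstrap.* For data $x=\{x_{k\ell}\}_{k\ne\ell}$ and $W\sim\mathrm{Dir}(1,\dots,1)$ on $n$ coordinates, let $$P^*_{x,W}=\sum_{k\neq\ell}\frac{W_kW_\ell}{\sum_{s\ne t}W_sW_t}\,\delta_{x_{k\ell}},$$ and let $B_x$ be the law of $T(P^*_{x,W})$. *Regularity of $T$.* Let $F:\mathcal X\to[0,\infty)$ be measurable with $\int\int_{\{c\ne c'\}}F(h(c,c'))\,Q(dc)\,Q(dc')<\infty$ for $\pi$-almost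 every $h$ ($F=0$ is always allowed). Call data $x$ *regular* if, for almost every $W$, $T$ is continuous at $P^*_{x,W}$ with respect to the weighted total variation distance $d_F(\mu,\nu)=\sup_A\left|\int_A(1+F)\,d\mu-\int_A(1+F)\,d\nu\right|$, the supremum being over measurable $A\subseteq\mathcal X$. *Conclusion.* 1. There are versions of the posteriors $\pi_\alpha(\theta\mid\cdot)$, $\alpha>0$, such that for almost all data $x$ (with respect to the law of the data under any $\alpha_0>0$), if $x$ is regular, then $\pi_\alpha(\theta\mid x)$ converges in distribution to $B_x$ as $\alpha\downarrow0$. 2. For any versions of the posteriors and any sequence $\alpha_m>0$ with $\alpha_m\to0$, for almost all data $x$ (in the same sense), if $x$ is regular, then $\pi_{\alpha_m}(\theta\mid x)$ converges in distribution to $B_x$. The limit $B_x$ depends only on $x$ and $T$, not on $Q$ or $\pi(h)$. -/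

import Mathlib

open MeasureTheory ProbabilityTheory Filter Topology
open scoped NNReal ENNReal

namespace DyadicBootstrap

/-- The `Gamma(a, 1)` distribution, with the usual convention that `Gamma(0, 1)` is the point mass
at `0`. -/
noncomputable def gammaLaw (a : ℝ) : Measure ℝ :=
  if a = 0 then Measure.dirac 0 else gammaMeasure a 1

/-- The Dirichlet distribution `Dir(a i : i ∈ ι)`: the law of `G i / ∑ j, G j` for independent
`G i ∼ Gamma(a i, 1)`. Parameters may vanish (the coordinate is then `0`), but not all of them.
For `a = 1` the `G i` are i.i.d. standard exponential. -/
noncomputable def dirichlet {ι : Type*} [Fintype ι] (a : ι → ℝ) : Measure (ι → ℝ) :=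
  (Measure.pi fun i => gammaLaw (a i)).map fun g i => g i / ∑ j, g j

/-- `D` is (the law of) the Dirichlet process `DP(Q, α)`: a random probability measure `P` on `C`
such that `(P(A_1), …, P(A_R)) ∼ Dir(α Q(A_1), …, α Q(A_R))` for every finite measurable
partition `A_1, …, A_R` of `C`. -/
structure IsDirichletProcess {C : Type*} [MeasurableSpace C] (Q : Measure C) (α : ℝ)
    (D : Measure (ProbabilityMeasure C)) : Prop where
  isProbabilityMeasure : IsProbabilityMeasure D
  map_partition : ∀ (R : ℕ) (A : Fin R → Set C), (∀ r, MeasurableSet (A r)) →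
    Pairwise (fun r s => Disjoint (A r) (A s)) → ⋃ r, A r = Set.univ →
    D.map (fun (P : ProbabilityMeasure C) r => (P : Measure C).real (A r)) = dirichlet fun r => α * Q.real (A r)

/-- Given `P`, draw `n` i.i.d. points from `P`. -/
noncomputable def iidKernel (C : Type*) [MeasurableSpace C] (n : ℕ) :
    Kernel (ProbabilityMeasure C) (Fin n → C) where
  toFun P := Measure.pi fun _ => (P : Measure C)
  measurable' := by
    refine Measurable.measure_of_isPiSystem_of_isProbabilityMeasure
      generateFrom_pi.symm isPiSystem_pi ?_
    rintro _ ⟨s, hs, rfl⟩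
    simp only [Measure.pi_pi]
    refine Finset.measurable_prod _ fun i _ => ?_
    exact (Measure.measurable_coe (hs i (Set.mem_univ i))).comp measurable_subtype_coe

instance (C : Type*) [MeasurableSpace C] (n : ℕ) : IsMarkovKernel (iidKernel C n) :=
  ⟨fun P => inferInstanceAs (IsProbabilityMeasure (Measure.pi fun _ : Fin n => (P : Measure C)))⟩

/-- Joint law of (the index `t` of the link function, `P_C`, `(C_1, …, C_n)`): the pair `(t, P_C)`
has law `π ⊗ D`, and given it the `C_k` are i.i.d. with law `P_C`. -/
noncomputable def jointLaw {H C : Type*} [MeasurableSpace H] [MeasurableSpace C]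
    (π : Measure H) (D : Measure (ProbabilityMeasure C)) (n : ℕ) :
    Measure ((H × ProbabilityMeasure C) × (Fin n → C)) :=
  (π.prod D) ⊗ₘ ((iidKernel C n).comap Prod.snd measurable_snd)

/-- `X_{kℓ} = h(C_k, C_ℓ)` is defined only when `C_k ≠ C_ℓ`, so the full array of dyadic data
`(X_{kℓ})_{k ≠ ℓ}` is observed exactly when the `C_k` are pairwise distinct. This is the joint law
given that event (the zero measure if the event is null). -/
noncomputable def modelLaw {H C : Type*} [MeasurableSpace H] [MeasurableSpace C]
    (π : Measure H) (D : Measure (ProbabilityMeasure C)) (n : ℕ) :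
    Measure ((H × ProbabilityMeasure C) × (Fin n → C)) :=
  (jointLaw π D n)[|{ω | Function.Injective ω.2}]

/-- Arrays `(x_{kℓ})_{k ≠ ℓ}` with `k, ℓ ∈ {1, …, n}`. -/
abbrev DyadicData (n : ℕ) (X : Type*) : Type _ := {p : Fin n × Fin n // p.1 ≠ p.2} → X

/-- The observed data `X_{kℓ} = h(C_k, C_ℓ)`, `k ≠ ℓ`. -/
def data {H C X : Type*} [MeasurableSpace C] (h : H → C → C → X) {n : ℕ}
    (ω : (H × ProbabilityMeasure C) × (Fin n → C)) : DyadicData n X :=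
  fun p => h ω.1.1 (ω.2 p.1.1) (ω.2 p.1.2)

/-- A measure regarded as an element of `Δ(X)`; an arbitrary point mass if it is not a
probability measure. -/
noncomputable def asProb {X : Type*} [MeasurableSpace X] [Nonempty X] (m : Measure X) :
    ProbabilityMeasure X :=
  open Classical in
  if hm : IsProbabilityMeasure m then ⟨m, hm⟩
  else ⟨Measure.dirac (Classical.arbitrary X), inferInstance⟩

/-- `P_{X_{ij}}`: the law of `f(C_i, C_j)` given `C_i ≠ C_j`, for `C_i, C_j` independent with
law `P`. -/
noncomputable def dyadLaw {C X : Type*} [MeasurableSpace C] [MeasurableSpace X] [Nonempty X]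
    (f : C → C → X) (P : ProbabilityMeasure C) : ProbabilityMeasure X :=
  asProb ((((P : Measure C).prod (P : Measure C))[|{p | p.1 ≠ p.2}]).map fun p => f p.1 p.2)

/-- The structural parameter `θ = T(P_{X_{ij}})`. -/
noncomputable def theta {H C X : Type*} [MeasurableSpace C] [MeasurableSpace X] [Nonempty X]
    (T : ProbabilityMeasure X → ℝ) (h : H → C → C → X) {n : ℕ}
    (ω : (H × ProbabilityMeasure C) × (Fin n → C)) : ℝ :=
  T (dyadLaw (h ω.1.1) ω.1.2)

/-- `∑_{k ≠ ℓ} (w_k w_ℓ / ∑_{s ≠ t} w_s w_t) δ_{x_{kℓ}}`. -/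
noncomputable def weightedEmpirical {X : Type*} [MeasurableSpace X] [Nonempty X] {n : ℕ}
    (x : DyadicData n X) (w : Fin n → ℝ) : ProbabilityMeasure X :=
  asProb (∑ p : {p : Fin n × Fin n // p.1 ≠ p.2},
    ENNReal.ofReal (w p.1.1 * w p.1.2 /
      ∑ q : {q : Fin n × Fin n // q.1 ≠ q.2}, w q.1.1 * w q.1.2) • Measure.dirac (x p))

/-- The law of a Bayesian bootstrap draw `T(∑_{k ≠ ℓ} (W_k W_ℓ / ∑_{s ≠ t} W_s W_t) δ_{x_{kℓ}})`,
`W ∼ Dir(1, …, 1)`, for the data `x`. -/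
noncomputable def bootstrapLaw {X : Type*} [MeasurableSpace X] [Nonempty X] {n : ℕ}
    (T : ProbabilityMeasure X → ℝ) (x : DyadicData n X) : ProbabilityMeasure ℝ :=
  asProb ((dirichlet fun _ : Fin n => (1 : ℝ)).map fun w => T (weightedEmpirical x w))

/-- Continuity of `T` at `μ` for total variation with weight `1 + F`, i.e. for the distance
`sup_A |∫_A (1 + F) dν - ∫_A (1 + F) dμ|`. For `F = 0` this is ordinary total variation. -/
def ContinuousAtTV {X : Type*} [MeasurableSpace X] (F : X → ℝ≥0)
    (T : ProbabilityMeasure X → ℝ) (μ : ProbabilityMeasure X) : Prop :=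
  ∀ ε : ℝ, 0 < ε → ∃ δ : ℝ, 0 < δ ∧ ∀ ν : ProbabilityMeasure X,
    (∀ A : Set X, MeasurableSet A →
      ∫⁻ y in A, (1 + F y) ∂(ν : Measure X) ≤
        ∫⁻ y in A, (1 + F y) ∂(μ : Measure X) + ENNReal.ofReal δ ∧
      ∫⁻ y in A, (1 + F y) ∂(μ : Measure X) ≤
        ∫⁻ y in A, (1 + F y) ∂(ν : Measure X) + ENNReal.ofReal δ) →
    |T ν - T μ| < ε

/-- For the data `x`, almost every Bayesian bootstrap draw of the distribution is a continuity
point of `T`. -/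
def ContinuousAtDraws {X : Type*} [MeasurableSpace X] [Nonempty X] {n : ℕ} (F : X → ℝ≥0)
    (T : ProbabilityMeasure X → ℝ) (x : DyadicData n X) : Prop :=
  ∀ᵐ w ∂(dirichlet fun _ : Fin n => (1 : ℝ)), ContinuousAtTV F T (weightedEmpirical x w)

/-- The Markov kernel `κ` is a version of the posterior of `θ` given the dyadic data, i.e. a regular conditional
distribution of `θ` given `(X_{kℓ})_{k ≠ ℓ}` in the model with prior `π ⊗ D` on `(h, P_C)`. -/
def IsPosterior {H C X : Type*} [MeasurableSpace H] [MeasurableSpace C] [MeasurableSpace X]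
    [Nonempty X] {n : ℕ} (h : H → C → C → X) (π : Measure H) (D : Measure (ProbabilityMeasure C))
    (T : ProbabilityMeasure X → ℝ) (κ : Kernel (DyadicData n X) ℝ) : Prop :=
  HasCondDistrib (theta T h) (data h) κ (modelLaw π D n)

/-- The probability measure `κ x` of a Markov kernel `κ`. -/
def kernelAt {Y Z : Type*} [MeasurableSpace Y] [MeasurableSpace Z] (κ : Kernel Y Z)
    (hκ : IsMarkovKernel κ) (x : Y) : ProbabilityMeasure Z :=
  ⟨κ x, hκ.isProbabilityMeasure x⟩

/-- The law of the dyadic data. -/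
noncomputable def dataLaw {H C X : Type*} [MeasurableSpace H] [MeasurableSpace C]
    [MeasurableSpace X] (h : H → C → C → X) (π : Measure H) (D : Measure (ProbabilityMeasure C))
    (n : ℕ) : Measure (DyadicData n X) :=
  (modelLaw π D n).map (data h)

end DyadicBootstrap

/-!
Write `P` for a draw from `DP(Q, α)` and `C_1, …, C_n` for an i.i.d. sample from `P`. The proof
rests on an exact description of the model given that the `C_k` are pairwise distinct.

*The law of the unobserved points is free of `α`.* Realize a Dirichlet vector by normalizing
independent Gamma variables. The probability that the `C_k` fall into given distinct cells of a
finite partition is the product of the corresponding coordinates, and size-biasing a Gamma variable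
adds an independent standard exponential variable to it (`gammaLaw_withDensity`,
`lintegral_prod_mul_dirichlet`). Passing to ever finer partitions gives
`IsDirichletProcess.compProd_restrict_injective`: on the event of distinct points, the joint law of
`(P, C)` is, up to a constant factor, that of an i.i.d. sample `C` from `Q` and of the normalization
of `s P₀ + ∑ k, e k δ_{C k}`, with `P₀ ∼ DP(Q, α)`, `s ∼ Gamma(α, 1)` and i.i.d. standard
exponential `e k`. Hence, given distinctness, neither the law of the index of the link function and
of the points `C_k` (`latentLaw`) nor the law of the data involves `α`
(`IsDirichletProcess.modelLaw_eq`, `IsDirichletProcess.dataLaw_eq`).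

*The limit given the unobserved points.* The law of a dyad under `s P₀ + ∑ k, e k δ_{C k}` is the
normalization of the sum of `∑ e k e l δ_{X k l}` over `k ≠ l` and of a remainder. By the moment
formulas for the Dirichlet process, the `(1 + F)`-mass of the remainder has expectation `O(α)`. As
normalization is stable in weighted total variation (`normalize_add_close`), the law of a dyad
approaches the bootstrap draw with weights `e k / ∑ j, e j`, and continuity of `T` at almost every
such draw gives `tendsto_integral_drawLaw`. The limit depends on the unobserved quantities only
through the data.

*Averaging.* Let `κ` be a regular conditional distribution of the unobserved quantities given the
data; it is the same for all `α`. Averaging the conditional law of `θ` over `κ` gives versions of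
the posteriors (`IsDirichletProcess.isPosterior`), and dominated convergence gives the limit at
every `x` for which `κ x` is carried by the latent values that produce `x`. The kernel `κ` exists
when the link function is indexed by a standard Borel space. This is no restriction: a jointly
measurable `h` depends on its index only through countably many events, so the index can be replaced
by a point of `ℕ → Bool` (`exists_factor`).

For a sequence `α_m` any other versions agree with these outside a countable union of null sets, and
the null sets are the same for all `α₀` because the law of the data is.
-/

namespace DyadicBootstrap

/-! ### Laplace transforms at the natural numbers -/

/-- The bounded function `x ↦ exp (-x)` on `[0, ∞)`. -/
noncomputable def expNeg : BoundedContinuousFunction ℝ≥0 ℝ :=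
  BoundedContinuousFunction.ofNormedAddCommGroup (fun x : ℝ≥0 => Real.exp (-(x : ℝ)))
    (by fun_prop) 1 (fun x => by
      rw [Real.norm_eq_abs, abs_of_pos (Real.exp_pos _)]
      exact Real.exp_le_one_iff.2 (by simp))

lemma expNeg_apply (x : ℝ≥0) : expNeg x = Real.exp (-(x : ℝ)) := rfl

/-- The powers of `x ↦ exp (-x)` span an algebra that separates the points of `[0, ∞)`, so a finite
measure there is determined by its integrals against these powers. -/
lemma ext_of_integral_expNeg_pow {μ ν : Measure ℝ≥0} [IsFiniteMeasure μ] [IsFiniteMeasure ν]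
    (h : ∀ k : ℕ, ∫ x, (expNeg x) ^ k ∂μ = ∫ x, (expNeg x) ^ k ∂ν) : μ = ν := by
  let A : StarSubalgebra ℝ (BoundedContinuousFunction ℝ≥0 ℝ) :=
    { Algebra.adjoin ℝ {expNeg} with
      star_mem' := fun {a} ha => by
        have : star a = a := by ext x; simp
        rw [this]; exact ha }
  refine ext_of_forall_mem_subalgebra_integral_eq_of_pseudoEMetric_complete_countable
    (𝕜 := ℝ) (A := A) ?_ ?_
  · intro x y hxy
    refine ⟨fun z => expNeg z, ⟨_, ⟨expNeg, Algebra.subset_adjoin (by simp), rfl⟩, rfl⟩, ?_⟩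
    simp only [expNeg_apply]
    intro h
    apply hxy
    have := Real.exp_injective h
    exact NNReal.coe_injective (by linarith)
  · intro g hg
    have hg' : g ∈ Submodule.span ℝ (Submonoid.closure {expNeg} : Set _) := by
      rw [← Algebra.adjoin_eq_span]; exact hg
    induction hg' using Submodule.span_induction with
    | mem x hx =>
      obtain ⟨k, rfl⟩ := Submonoid.mem_closure_singleton.1 hx
      simpa using h k
    | zero => simp
    | add x y hx hy ihx ihy =>
      have hx' := ihx (by rw [← Algebra.adjoin_eq_span] at hx; exact hx)
      have hy' := ihy (by rw [← Algebra.adjoin_eq_span] at hy; exact hy)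
      simp only [BoundedContinuousFunction.coe_add, Pi.add_apply]
      rw [integral_add (x.integrable μ) (y.integrable μ),
        integral_add (x.integrable ν) (y.integrable ν), hx', hy']
    | smul a x hx ih =>
      have hx' := ih (by rw [← Algebra.adjoin_eq_span] at hx; exact hx)
      simp only [BoundedContinuousFunction.coe_smul, smul_eq_mul]
      rw [integral_const_mul, integral_const_mul, hx']

/-- Finite measures on `[0, ∞)` are determined by their Laplace transforms at natural numbers. -/
lemma ext_of_laplace {μ ν : Measure ℝ} [IsFiniteMeasure μ] [IsFiniteMeasure ν]
    (hμ : ∀ᵐ x ∂μ, 0 ≤ x) (hν : ∀ᵐ x ∂ν, 0 ≤ x)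
    (h : ∀ k : ℕ, ∫⁻ x, ENNReal.ofReal (Real.exp (-(k * x))) ∂μ =
      ∫⁻ x, ENNReal.ofReal (Real.exp (-(k * x))) ∂ν) : μ = ν := by
  have key : ∀ ρ : Measure ℝ, IsFiniteMeasure ρ → (∀ᵐ x ∂ρ, 0 ≤ x) →
      (ρ.map Real.toNNReal).map ((↑) : ℝ≥0 → ℝ) = ρ := by
    intro ρ _ hρ
    rw [Measure.map_map (by fun_prop) (by fun_prop)]
    conv_rhs => rw [← Measure.map_id (μ := ρ)]
    refine Measure.map_congr ?_
    filter_upwards [hρ] with x hx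
    simp [hx]
  have key2 : ∀ ρ : Measure ℝ, IsFiniteMeasure ρ → (∀ᵐ x ∂ρ, 0 ≤ x) → ∀ k : ℕ,
      ∫ x, (expNeg x) ^ k ∂(ρ.map Real.toNNReal) =
      (∫⁻ x, ENNReal.ofReal (Real.exp (-(k * x))) ∂ρ).toReal := by
    intro ρ _ hρ k
    rw [integral_map (by fun_prop) (by fun_prop), integral_eq_lintegral_of_nonneg_ae
      (ae_of_all _ fun x => by simp only [expNeg_apply]; positivity) (by fun_prop)]
    congr 1
    refine lintegral_congr_ae ?_
    filter_upwards [hρ] with x hx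
    rw [expNeg_apply, Real.coe_toNNReal x hx, ← Real.exp_nat_mul]
    ring_nf
  rw [← key μ inferInstance hμ, ← key ν inferInstance hν]
  congr 1
  refine ext_of_integral_expNeg_pow fun k => ?_
  rw [key2 μ inferInstance hμ, key2 ν inferInstance hν, h]

/-! ### Gamma distributions -/

instance isProbabilityMeasure_gammaLaw_one : IsProbabilityMeasure (gammaLaw 1) := by
  simp only [gammaLaw, one_ne_zero, if_false]
  exact isProbabilityMeasure_gammaMeasure one_pos one_pos

lemma isProbabilityMeasure_gammaLaw {a : ℝ} (ha : 0 ≤ a) : IsProbabilityMeasure (gammaLaw a) := by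
  rcases ha.eq_or_lt with rfl | ha
  · simp only [gammaLaw, if_true]; infer_instance
  · simp only [gammaLaw, ha.ne', if_false]; exact isProbabilityMeasure_gammaMeasure ha one_pos

lemma gammaMeasure_pos {a r : ℝ} : ∀ᵐ x ∂(gammaMeasure a r), 0 < x := by
  have : ∀ᵐ x : ℝ, x ≠ 0 := by simp [ae_iff]
  rw [gammaMeasure, ae_withDensity_iff (by unfold gammaPDF; fun_prop)]
  filter_upwards [this] with x hx0 hx
  by_contra hlt
  exact hx (gammaPDF_of_neg (lt_of_le_of_ne (not_lt.1 hlt) hx0))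

lemma gammaLaw_pos {a : ℝ} (ha : 0 < a) : ∀ᵐ x ∂(gammaLaw a), 0 < x := by
  simp only [gammaLaw, ha.ne', if_false]; exact gammaMeasure_pos

lemma gammaLaw_nonneg {a : ℝ} (ha : 0 ≤ a) : ∀ᵐ x ∂(gammaLaw a), 0 ≤ x := by
  rcases ha.eq_or_lt with rfl | ha
  · simp [gammaLaw]
  · filter_upwards [gammaLaw_pos ha] with x hx using hx.le

lemma lintegral_exp_gammaLaw {a t : ℝ} (ha : 0 ≤ a) (ht : 0 ≤ t) :
    ∫⁻ x, ENNReal.ofReal (Real.exp (-(t * x))) ∂(gammaLaw a) =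
      ENNReal.ofReal ((1 + t) ^ (-a)) := by
  rcases ha.eq_or_lt with rfl | ha
  · simp [gammaLaw]
  · have h1 : (0 : ℝ) < 1 + t := by linarith
    simp only [gammaLaw, ha.ne', if_false, gammaMeasure]
    rw [lintegral_withDensity_eq_lintegral_mul _ (by unfold gammaPDF; fun_prop) (by fun_prop)]
    -- tilting `Gamma(a, 1)` by `exp (-t x)` gives a multiple of `Gamma(a, 1 + t)`
    have : ∀ x, (gammaPDF a 1 * fun x => ENNReal.ofReal (Real.exp (-(t * x)))) x =
        ENNReal.ofReal ((1 + t) ^ (-a)) * gammaPDF a (1 + t) x := by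
      intro x
      rw [Pi.mul_apply, gammaPDF, gammaPDF, ← ENNReal.ofReal_mul' (Real.exp_pos _).le,
        ← ENNReal.ofReal_mul (by positivity), gammaPDFReal, gammaPDFReal]
      congr 1
      split_ifs with hx
      · rw [show -((1 + t) * x) = -(1 * x) + -(t * x) by ring, Real.exp_add, Real.rpow_neg h1.le]
        have := (Real.rpow_pos_of_pos h1 a).ne'
        have := (Real.Gamma_pos_of_pos ha).ne'
        rw [Real.one_rpow]
        field_simp
      · simp
    rw [lintegral_congr this, lintegral_const_mul _ (by unfold gammaPDF; fun_prop),
      lintegral_gammaPDF_eq_one ha h1, mul_one]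

/-- Size-biasing a Gamma distribution raises its parameter by one. -/
lemma gammaLaw_withDensity {a : ℝ} (ha : 0 ≤ a) :
    (gammaLaw a).withDensity (fun x => ENNReal.ofReal x) =
      ENNReal.ofReal a • gammaLaw (a + 1) := by
  rcases ha.eq_or_lt with rfl | ha
  · simp only [gammaLaw, if_true]
    ext s hs
    rw [withDensity_apply _ hs]
    have h0 : ∫⁻ x, ENNReal.ofReal x ∂(Measure.dirac (0 : ℝ)) = 0 := by simp
    simpa using (setLIntegral_le_lintegral s _).trans h0.le
  · have ha1 : a + 1 ≠ 0 := by positivity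
    simp only [gammaLaw, ha.ne', ha1, if_false, gammaMeasure]
    rw [← withDensity_mul _ (by unfold gammaPDF; fun_prop) (by fun_prop),
      ← withDensity_smul _ (by unfold gammaPDF; fun_prop)]
    congr 1
    ext x
    rw [Pi.mul_apply, Pi.smul_apply, smul_eq_mul, gammaPDF, gammaPDF,
      ← ENNReal.ofReal_mul ha.le]
    rcases lt_or_ge x 0 with hx | hx
    · simp [gammaPDFReal, hx.not_ge]
    rw [← ENNReal.ofReal_mul' hx]
    congr 1
    simp only [gammaPDFReal, hx, if_true, add_sub_cancel_right, Real.one_rpow]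
    rw [Real.Gamma_add_one ha.ne']
    have := (Real.Gamma_pos_of_pos ha).ne'
    rcases hx.eq_or_lt with rfl | hx
    · simp [Real.zero_rpow ha.ne']
    · rw [Real.rpow_sub_one hx.ne']
      field_simp

lemma lintegral_ofReal_gammaLaw {a : ℝ} (ha : 0 ≤ a) :
    ∫⁻ x, ENNReal.ofReal x ∂(gammaLaw a) = ENNReal.ofReal a := by
  have := isProbabilityMeasure_gammaLaw (a := a + 1) (by linarith)
  have h := congrArg (fun μ => μ Set.univ) (gammaLaw_withDensity ha)
  simpa [withDensity_apply] using h

lemma lintegral_exp_add_prod {μ ν : Measure ℝ} [SFinite μ] [SFinite ν] (t : ℝ) :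
    ∫⁻ x, ENNReal.ofReal (Real.exp (-(t * x))) ∂((μ.prod ν).map fun p => p.1 + p.2) =
      (∫⁻ x, ENNReal.ofReal (Real.exp (-(t * x))) ∂μ) *
        ∫⁻ x, ENNReal.ofReal (Real.exp (-(t * x))) ∂ν := by
  rw [lintegral_map (by fun_prop) (by fun_prop), ← lintegral_prod_mul (by fun_prop) (by fun_prop)]
  refine lintegral_congr fun p => ?_
  rw [← ENNReal.ofReal_mul (Real.exp_pos _).le, ← Real.exp_add]
  ring_nf

lemma gammaLaw_add_one {a : ℝ} (ha : 0 ≤ a) :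
    ((gammaLaw a).prod (gammaLaw 1)).map (fun p => p.1 + p.2) = gammaLaw (a + 1) := by
  have := isProbabilityMeasure_gammaLaw ha
  have := isProbabilityMeasure_gammaLaw (a := a + 1) (by linarith)
  have : IsProbabilityMeasure (((gammaLaw a).prod (gammaLaw 1)).map (fun p => p.1 + p.2)) :=
    Measure.isProbabilityMeasure_map (by fun_prop)
  refine ext_of_laplace ?_ (gammaLaw_nonneg (by linarith)) fun k => ?_
  · rw [ae_map_iff (by fun_prop) measurableSet_Ici]
    have h1 : ∀ᵐ p ∂((gammaLaw a).prod (gammaLaw 1)), 0 ≤ p.1 :=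
      Measure.quasiMeasurePreserving_fst.ae (gammaLaw_nonneg ha)
    have h2 : ∀ᵐ p ∂((gammaLaw a).prod (gammaLaw 1)), 0 ≤ p.2 :=
      Measure.quasiMeasurePreserving_snd.ae (gammaLaw_nonneg zero_le_one)
    filter_upwards [h1, h2] with p h1 h2 using add_nonneg h1 h2
  · have h1 : (0 : ℝ) < 1 + k := by positivity
    rw [lintegral_exp_add_prod, lintegral_exp_gammaLaw ha (by positivity),
      lintegral_exp_gammaLaw zero_le_one (by positivity),
      lintegral_exp_gammaLaw (by linarith) (by positivity), ← ENNReal.ofReal_mul (by positivity),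
      ← Real.rpow_add h1]
    ring_nf

/-- Exponential tilting of a Gamma distribution is a change of scale. -/
lemma gammaLaw_tilt {a t : ℝ} (ha : 0 ≤ a) (ht : 0 ≤ t) :
    (gammaLaw a).withDensity (fun x => ENNReal.ofReal (Real.exp (-(t * x)))) =
      ENNReal.ofReal ((1 + t) ^ (-a)) • (gammaLaw a).map (fun x => x / (1 + t)) := by
  have := isProbabilityMeasure_gammaLaw ha
  have h1 : (0 : ℝ) < 1 + t := by linarith
  have hfin : IsFiniteMeasure
      ((gammaLaw a).withDensity (fun x => ENNReal.ofReal (Real.exp (-(t * x))))) := by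
    refine isFiniteMeasure_withDensity ?_
    rw [lintegral_exp_gammaLaw ha ht]; exact ENNReal.ofReal_ne_top
  have : IsFiniteMeasure (ENNReal.ofReal ((1 + t) ^ (-a)) •
      (gammaLaw a).map (fun x => x / (1 + t))) :=
    Measure.smul_finite _ ENNReal.ofReal_ne_top
  refine ext_of_laplace ?_ ?_ fun k => ?_
  · exact (withDensity_absolutelyContinuous _ _).ae_le (gammaLaw_nonneg ha)
  · refine (Measure.smul_absolutelyContinuous).ae_le ?_
    refine (ae_map_iff (by fun_prop) measurableSet_Ici).2 ?_
    filter_upwards [gammaLaw_nonneg ha] with x hx using div_nonneg hx h1.le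
  · rw [lintegral_withDensity_eq_lintegral_mul _ (by fun_prop) (by fun_prop),
      lintegral_smul_measure, lintegral_map (by fun_prop) (by fun_prop)]
    have e1 : ∀ x, ((fun x => ENNReal.ofReal (Real.exp (-(t * x)))) *
        fun x => ENNReal.ofReal (Real.exp (-(k * x)))) x =
        ENNReal.ofReal (Real.exp (-((t + k) * x))) := by
      intro x
      rw [Pi.mul_apply, ← ENNReal.ofReal_mul (Real.exp_pos _).le, ← Real.exp_add]
      ring_nf
    have e2 : ∀ x, ENNReal.ofReal (Real.exp (-(k * (x / (1 + t))))) =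
        ENNReal.ofReal (Real.exp (-((k / (1 + t)) * x))) := by
      intro x; congr 3; ring
    rw [lintegral_congr e1, lintegral_congr e2, lintegral_exp_gammaLaw ha (by positivity),
      lintegral_exp_gammaLaw ha (by positivity), smul_eq_mul, ← ENNReal.ofReal_mul (by positivity),
      ← Real.mul_rpow h1.le (by positivity)]
    congr 2
    field_simp
    ring

/-! ### Vectors of independent Gamma variables and the Dirichlet distribution -/

lemma measurable_add_jumps {J : Type*} [DecidableEq J] {n : ℕ} (r : Fin n → J) :
    Measurable fun (p : (J → ℝ) × (Fin n → ℝ)) (j : J) =>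
      p.1 j + ∑ i, if r i = j then p.2 i else 0 :=
  measurable_pi_lambda _ fun j => Measurable.add (by fun_prop)
    (Finset.measurable_sum _ fun i _ => by split_ifs <;> fun_prop)

section Pi

variable {J : Type*} [Fintype J]

lemma lintegral_pi_prod {μ : J → Measure ℝ} [∀ j, IsProbabilityMeasure (μ j)]
    {f : J → ℝ → ℝ≥0∞} (hf : ∀ j, Measurable (f j)) :
    ∫⁻ g, ∏ j, f j (g j) ∂(Measure.pi μ) = ∏ j, ∫⁻ x, f j x ∂(μ j) := by
  have hind : iIndepFun (fun (j : J) (g : J → ℝ) => f j (g j)) (Measure.pi μ) :=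
    iIndepFun_pi (X := fun j => f j) fun j => (hf j).aemeasurable
  rw [lintegral_prod_eq_prod_lintegral_of_indepFun Finset.univ _ hind (fun j => by fun_prop)]
  refine Finset.prod_congr rfl fun j _ => ?_
  rw [← (measurePreserving_eval μ j).map_eq, lintegral_map (hf j) (measurable_pi_apply j)]

lemma pi_withDensity {μ : J → Measure ℝ} [∀ j, IsProbabilityMeasure (μ j)]
    {f : J → ℝ → ℝ≥0∞} (hf : ∀ j, Measurable (f j))
    [∀ j, SigmaFinite ((μ j).withDensity (f j))] :
    (Measure.pi μ).withDensity (fun g => ∏ j, f j (g j)) =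
      Measure.pi fun j => (μ j).withDensity (f j) := by
  refine (Measure.pi_eq fun s hs => ?_).symm
  rw [withDensity_apply _ (MeasurableSet.univ_pi hs), ← lintegral_indicator (.univ_pi hs)]
  have : ∀ g : J → ℝ, (Set.univ.pi s).indicator (fun g => ∏ j, f j (g j)) g =
      ∏ j, (s j).indicator (f j) (g j) := by
    intro g
    by_cases hg : g ∈ Set.univ.pi s
    · rw [Set.indicator_of_mem hg]
      exact Finset.prod_congr rfl fun j _ =>
        (Set.indicator_of_mem (hg j (Set.mem_univ j)) _).symm
    · rw [Set.indicator_of_notMem hg]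
      obtain ⟨j, hj⟩ : ∃ j, g j ∉ s j := by simpa [Set.mem_pi] using hg
      exact (Finset.prod_eq_zero (Finset.mem_univ j) (Set.indicator_of_notMem hj _)).symm
  rw [lintegral_congr this, lintegral_pi_prod fun j => (hf j).indicator (hs j)]
  refine Finset.prod_congr rfl fun j _ => ?_
  rw [withDensity_apply _ (hs j), lintegral_indicator (hs j)]

lemma pi_smul {μ : J → Measure ℝ} [∀ j, IsFiniteMeasure (μ j)] (c : J → ℝ≥0∞)
    (hc : ∀ j, c j ≠ ∞) :
    Measure.pi (fun j => c j • μ j) = (∏ j, c j) • Measure.pi μ := by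
  have : ∀ j, IsFiniteMeasure (c j • μ j) := fun j => Measure.smul_finite _ (hc j)
  refine Measure.pi_eq fun s hs => ?_
  simp [Measure.pi_pi, Finset.prod_mul_distrib]

/-- The joint law of independent `Gamma(a j, 1)` variables. -/
noncomputable def gammaPi (a : J → ℝ) : Measure (J → ℝ) := Measure.pi fun j => gammaLaw (a j)

lemma isProbabilityMeasure_gammaPi {a : J → ℝ} (ha : ∀ j, 0 ≤ a j) :
    IsProbabilityMeasure (gammaPi a) := by
  have := fun j => isProbabilityMeasure_gammaLaw (ha j)
  unfold gammaPi; infer_instance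

instance isProbabilityMeasure_gammaPi_one : IsProbabilityMeasure (gammaPi fun _ : J => (1 : ℝ)) :=
  isProbabilityMeasure_gammaPi fun _ => zero_le_one

lemma gammaPi_nonneg {a : J → ℝ} (ha : ∀ j, 0 ≤ a j) : ∀ᵐ g ∂(gammaPi a), ∀ j, 0 ≤ g j := by
  have := fun j => isProbabilityMeasure_gammaLaw (ha j)
  rw [ae_all_iff]
  intro j
  exact (Measure.quasiMeasurePreserving_eval _ j).ae (gammaLaw_nonneg (ha j))

lemma dirichlet_eq (a : J → ℝ) :
    dirichlet a = (gammaPi a).map fun g i => g i / ∑ j, g j := rfl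

lemma measurable_normalize : Measurable fun (g : J → ℝ) (i : J) => g i / ∑ j, g j := by
  fun_prop

lemma isProbabilityMeasure_dirichlet {a : J → ℝ} (ha : ∀ j, 0 ≤ a j) :
    IsProbabilityMeasure (dirichlet a) := by
  have := isProbabilityMeasure_gammaPi ha
  rw [dirichlet_eq]; exact Measure.isProbabilityMeasure_map measurable_normalize.aemeasurable

/-- Exponential tilting of the total of independent Gamma variables is a common change of scale. -/
lemma gammaPi_tilt {a : J → ℝ} (ha : ∀ j, 0 ≤ a j) {t : ℝ} (ht : 0 ≤ t) :
    (gammaPi a).withDensity (fun g => ENNReal.ofReal (Real.exp (-(t * ∑ j, g j)))) =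
      ENNReal.ofReal ((1 + t) ^ (-∑ j, a j)) • (gammaPi a).map (fun g j => g j / (1 + t)) := by
  have := fun j => isProbabilityMeasure_gammaLaw (ha j)
  have h1 : (0 : ℝ) < 1 + t := by linarith
  have hfin : ∀ j, IsFiniteMeasure
      ((gammaLaw (a j)).withDensity (fun x => ENNReal.ofReal (Real.exp (-(t * x))))) := by
    intro j
    rw [gammaLaw_tilt (ha j) ht]
    exact Measure.smul_finite _ ENNReal.ofReal_ne_top
  have e : ∀ g : J → ℝ, ENNReal.ofReal (Real.exp (-(t * ∑ j, g j))) =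
      ∏ j, ENNReal.ofReal (Real.exp (-(t * g j))) := by
    intro g
    rw [← ENNReal.ofReal_prod_of_nonneg fun j _ => (Real.exp_pos _).le, ← Real.exp_sum,
      Finset.mul_sum, Finset.sum_neg_distrib]
  simp_rw [e]
  rw [gammaPi, pi_withDensity (f := fun _ x => ENNReal.ofReal (Real.exp (-(t * x))))
    (fun j => by fun_prop)]
  simp_rw [fun j => gammaLaw_tilt (ha j) ht]
  rw [pi_smul _ fun j => ENNReal.ofReal_ne_top,
    Measure.pi_map_pi (f := fun _ x => x / (1 + t)) fun j => by fun_prop]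
  congr 1
  rw [← ENNReal.ofReal_prod_of_nonneg fun j _ => by positivity, ← Finset.sum_neg_distrib,
    Real.rpow_sum_of_pos h1]

/-- For independent Gamma variables, the normalized vector is independent of the total: tilting by
`exp (-k S)` only rescales the vector, so does not change the law of the normalized vector. -/
lemma map_normalize_sum_gammaPi {a : J → ℝ} (ha : ∀ j, 0 ≤ a j) :
    (gammaPi a).map (fun g => ((fun i => g i / ∑ j, g j), ∑ j, g j)) =
      (dirichlet a).prod (gammaLaw (∑ j, a j)) := by
  have hprob := isProbabilityMeasure_gammaPi ha
  have hA : 0 ≤ ∑ j, a j := Finset.sum_nonneg fun j _ => ha j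
  have := isProbabilityMeasure_gammaLaw hA
  have := isProbabilityMeasure_dirichlet ha
  have hmeas : Measurable fun g : J → ℝ => ((fun i => g i / ∑ j, g j), ∑ j, g j) := by fun_prop
  refine (Measure.prod_eq fun s t hs ht => ?_).symm
  have hpre : MeasurableSet ((fun (g : J → ℝ) i => g i / ∑ j, g j) ⁻¹' s) :=
    measurable_normalize hs
  have key : ((gammaPi a).restrict ((fun (g : J → ℝ) i => g i / ∑ j, g j) ⁻¹' s)).map
      (fun g => ∑ j, g j) = (dirichlet a s) • gammaLaw (∑ j, a j) := by
    have : IsFiniteMeasure ((dirichlet a s) • gammaLaw (∑ j, a j)) :=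
      Measure.smul_finite _ (measure_ne_top _ _)
    refine ext_of_laplace ?_ ?_ fun k => ?_
    · refine (ae_map_iff (by fun_prop) measurableSet_Ici).2 ?_
      refine ae_restrict_of_ae ?_
      filter_upwards [gammaPi_nonneg ha] with g hg
      exact Finset.sum_nonneg fun j _ => hg j
    · exact (Measure.smul_absolutelyContinuous).ae_le (gammaLaw_nonneg hA)
    · rw [lintegral_map (by fun_prop) (by fun_prop), lintegral_smul_measure,
        lintegral_exp_gammaLaw hA (Nat.cast_nonneg k), ← withDensity_apply _ hpre,
        gammaPi_tilt ha (Nat.cast_nonneg k), Measure.smul_apply, smul_eq_mul, smul_eq_mul, mul_comm,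
        Measure.map_apply (by fun_prop) hpre, dirichlet_eq,
        Measure.map_apply measurable_normalize hs]
      congr 2
      ext g
      have h1 : (1 : ℝ) + k ≠ 0 := by positivity
      simp only [Set.mem_preimage, ← Finset.sum_div]
      rw [show (fun i => g i / (1 + (k : ℝ)) / ((∑ j, g j) / (1 + k))) =
        fun i => g i / ∑ j, g j from funext fun i => div_div_div_cancel_right₀ h1 _ _]
  rw [Measure.map_apply hmeas (hs.prod ht)]
  have := congrArg (fun ν => ν t) key
  simp only [Measure.smul_apply, smul_eq_mul] at this
  rw [← this, Measure.map_apply (by fun_prop) ht,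
    Measure.restrict_apply ((by fun_prop : Measurable fun g : J → ℝ => ∑ j, g j) ht)]
  congr 1
  ext g
  simp [and_comm]

lemma lintegral_dirichlet_prod_gammaLaw {a : J → ℝ} (ha : ∀ j, 0 ≤ a j)
    {f : (J → ℝ) × ℝ → ℝ≥0∞} (hf : Measurable f) :
    ∫⁻ p, f p ∂((dirichlet a).prod (gammaLaw (∑ j, a j))) =
      ∫⁻ g, f ((fun i => g i / ∑ j, g j), ∑ j, g j) ∂(gammaPi a) := by
  rw [← map_normalize_sum_gammaPi ha, lintegral_map hf (by fun_prop)]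

lemma map_comp_gammaPi {a : J → ℝ} (ha : ∀ j, 0 ≤ a j) {I : Type*} [Fintype I] {r : I → J}
    (hr : Function.Injective r) :
    (gammaPi a).map (fun g i => g (r i)) = gammaPi fun i => a (r i) := by
  have := fun j => isProbabilityMeasure_gammaLaw (ha j)
  have := isProbabilityMeasure_gammaPi ha
  have hind : iIndepFun (fun (j : J) (g : J → ℝ) => g j) (gammaPi a) :=
    iIndepFun_pi (X := fun _ x => x) fun j => aemeasurable_id
  have h2 := hind.precomp hr
  rw [iIndepFun_iff_map_fun_eq_pi_map fun i => (measurable_pi_apply (r i)).aemeasurable] at h2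
  rw [h2]
  unfold gammaPi
  congr 1
  ext1 i
  exact (measurePreserving_eval (fun j : J => gammaLaw (a j)) (r i)).map_eq

lemma map_comp_dirichlet {a : J → ℝ} (ha : ∀ j, 0 ≤ a j) {I : Type*} [Fintype I] (r : I ≃ J) :
    (dirichlet a).map (fun g i => g (r i)) = dirichlet fun i => a (r i) := by
  rw [dirichlet_eq, dirichlet_eq, ← map_comp_gammaPi ha r.injective,
    Measure.map_map (by fun_prop) measurable_normalize,
    Measure.map_map measurable_normalize (by fun_prop)]
  congr 1
  ext g i
  simp [Equiv.sum_comp r g]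

/-- Size-biasing independent Gamma variables in distinct coordinates `r i` adds an independent
standard exponential variable to each of these coordinates. -/
lemma gammaPi_withDensity {a : J → ℝ} (ha : ∀ j, 0 ≤ a j) [DecidableEq J] {n : ℕ} {r : Fin n → J}
    (hr : Function.Injective r) :
    (gammaPi a).withDensity (fun g => ∏ i, ENNReal.ofReal (g (r i))) =
      (∏ i, ENNReal.ofReal (a (r i))) •
        ((gammaPi a).prod (gammaPi fun _ : Fin n => (1 : ℝ))).map
          (fun p j => p.1 j + ∑ i, if r i = j then p.2 i else 0) := by
  have hprob := fun j => isProbabilityMeasure_gammaLaw (ha j)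
  have hprobpi := isProbabilityMeasure_gammaPi ha
  let R : Finset J := Finset.univ.image r
  have prodR : ∀ v : J → ℝ≥0∞, ∏ i, v (r i) = ∏ j, if j ∈ R then v j else 1 := by
    intro v
    rw [Finset.prod_ite_mem, Finset.univ_inter, Finset.prod_image fun x _ y _ h => hr h]
  have h1 : ∀ j, (gammaLaw (a j)).withDensity
      (fun x => if j ∈ R then ENNReal.ofReal x else 1) =
      (if j ∈ R then ENNReal.ofReal (a j) else 1) •
        ((gammaLaw (a j)).prod (gammaLaw 1)).map
          (fun p => p.1 + if j ∈ R then p.2 else 0) := by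
    intro j
    by_cases hj : j ∈ R
    · simp only [hj, if_true]
      rw [gammaLaw_withDensity (ha j), gammaLaw_add_one (ha j)]
    · simp only [hj, if_false, add_zero, one_smul]
      rw [show (fun _ : ℝ => (1 : ℝ≥0∞)) = 1 from rfl, withDensity_one]
      exact Measure.fst_prod.symm
  have hfin : ∀ j, IsFiniteMeasure ((gammaLaw (a j)).withDensity
      (fun x => if j ∈ R then ENNReal.ofReal x else 1)) := by
    intro j
    rw [h1]
    refine Measure.smul_finite _ ?_
    split_ifs <;> simp
  have hprob2 : ∀ j, IsProbabilityMeasure (((gammaLaw (a j)).prod (gammaLaw 1)).map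
      (fun p => p.1 + if j ∈ R then p.2 else 0)) := fun j =>
    Measure.isProbabilityMeasure_map (by split_ifs <;> fun_prop)
  have e0 : ∀ g : J → ℝ, ∏ i, ENNReal.ofReal (g (r i)) =
      ∏ j, (fun x => if j ∈ R then ENNReal.ofReal x else 1) (g j) := fun g =>
    prodR fun j => ENNReal.ofReal (g j)
  simp_rw [e0]
  rw [gammaPi, pi_withDensity (f := fun j x => if j ∈ R then ENNReal.ofReal x else 1)
    (fun j => by split_ifs <;> fun_prop)]
  simp_rw [h1]
  rw [pi_smul _ (fun j => by split_ifs <;> simp), ← prodR fun j => ENNReal.ofReal (a j)]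
  congr 1
  rw [← Measure.pi_map_pi fun j => by split_ifs <;> fun_prop]
  have hmp := (measurePreserving_arrowProdEquivProdArrow ℝ ℝ J (fun j => gammaLaw (a j))
    (fun _ => gammaLaw 1)).symm.map_eq
  have hm : Measurable fun (x : J → ℝ × ℝ) (j : J) => (x j).1 + if j ∈ R then (x j).2 else 0 :=
    measurable_pi_lambda _ fun j => by split_ifs <;> fun_prop
  rw [← hmp, Measure.map_map hm (MeasurableEquiv.measurable _)]
  rw [← gammaPi, ← gammaPi, ← map_comp_gammaPi (a := fun _ => 1) (fun _ => zero_le_one) hr,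
    ← Measure.map_id (μ := gammaPi a),
    Measure.map_prod_map _ _ measurable_id (by fun_prop), Measure.map_id,
    Measure.map_map (measurable_add_jumps r) (by fun_prop)]
  congr 1
  ext p j
  simp only [Function.comp, Prod.map, id]
  congr 1
  by_cases hj : j ∈ R
  · obtain ⟨i, -, rfl⟩ := Finset.mem_image.1 hj
    simp only [hj, if_true, hr.eq_iff]
    simp
    rfl
  · have : ∀ i, r i ≠ j := fun i h => hj (Finset.mem_image.2 ⟨i, Finset.mem_univ _, h⟩)
    simp [hj, this]

/-- Size-biasing a Dirichlet vector `y` in distinct coordinates `r i`: after independent Gamma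
scaling to `s • y`, it amounts to adding independent standard exponential variables to these
coordinates and normalizing again. -/
lemma lintegral_prod_mul_dirichlet {a : J → ℝ} (ha : ∀ j, 0 ≤ a j) [DecidableEq J] {n : ℕ}
    {r : Fin n → J} (hr : Function.Injective r) {f : (J → ℝ) → ℝ≥0∞} (hf : Measurable f) :
    (∫⁻ s, ENNReal.ofReal s ^ n ∂(gammaLaw (∑ j, a j))) *
      ∫⁻ y, (∏ i, ENNReal.ofReal (y (r i))) * f y ∂(dirichlet a) =
    (∏ i, ENNReal.ofReal (a (r i))) *
      ∫⁻ p, f (fun j => (p.2.1 * p.1 j + ∑ i, if r i = j then p.2.2 i else 0) /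
          (p.2.1 + ∑ i, p.2.2 i))
        ∂((dirichlet a).prod ((gammaLaw (∑ j, a j)).prod
          (gammaPi fun _ : Fin n => (1 : ℝ)))) := by
  have hprobpi := isProbabilityMeasure_gammaPi ha
  have hA : 0 ≤ ∑ j, a j := Finset.sum_nonneg fun j _ => ha j
  have := isProbabilityMeasure_gammaLaw hA
  have hF : Measurable fun g : J → ℝ => f fun i => g i / ∑ j, g j := hf.comp measurable_normalize
  have hcancel : ∀ g : J → ℝ, (∀ j, 0 ≤ g j) → ∀ j, (∑ j, g j) * (g j / ∑ j, g j) = g j := by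
    intro g hg j
    by_cases h0 : ∑ j, g j = 0
    · rw [h0, zero_mul, (Finset.sum_eq_zero_iff_of_nonneg fun j _ => hg j).1 h0 j
        (Finset.mem_univ j)]
    · field_simp
  have hd := isProbabilityMeasure_dirichlet ha
  have lhs : (∫⁻ s, ENNReal.ofReal s ^ n ∂(gammaLaw (∑ j, a j))) *
      ∫⁻ y, (∏ i, ENNReal.ofReal (y (r i))) * f y ∂(dirichlet a) =
      ∫⁻ g, (∏ i, ENNReal.ofReal (g (r i))) * f (fun i => g i / ∑ j, g j) ∂(gammaPi a) := by
    rw [mul_comm, ← lintegral_prod_mul (by fun_prop) (by fun_prop),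
      lintegral_dirichlet_prod_gammaLaw ha (by fun_prop)]
    refine lintegral_congr_ae ?_
    filter_upwards [gammaPi_nonneg ha] with g hg
    have : (∏ i, ENNReal.ofReal (g (r i))) =
        (∏ i, ENNReal.ofReal (g (r i) / ∑ j, g j)) * ENNReal.ofReal (∑ j, g j) ^ n := by
      rw [← Fin.prod_const, ← Finset.prod_mul_distrib]
      refine Finset.prod_congr rfl fun i _ => ?_
      rw [mul_comm, ← ENNReal.ofReal_mul (Finset.sum_nonneg fun j _ => hg j), hcancel g hg]
    rw [this]
    ring
  rw [lhs]
  have h2 : ∫⁻ g, (∏ i, ENNReal.ofReal (g (r i))) * f (fun i => g i / ∑ j, g j) ∂(gammaPi a) =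
      ∫⁻ g, f (fun i => g i / ∑ j, g j)
        ∂((gammaPi a).withDensity (fun g => ∏ i, ENNReal.ofReal (g (r i)))) := by
    rw [lintegral_withDensity_eq_lintegral_mul _ (by fun_prop) hF]
    rfl
  rw [h2, gammaPi_withDensity ha hr, lintegral_smul_measure, smul_eq_mul,
    lintegral_map hF (measurable_add_jumps r)]
  refine congrArg _ ((lintegral_prod_symm _
    (hF.comp (measurable_add_jumps r)).aemeasurable).trans ?_)
  have hm : Measurable fun p : (J → ℝ) × ℝ × (Fin n → ℝ) =>
      f (fun j => (p.2.1 * p.1 j + ∑ i, if r i = j then p.2.2 i else 0) /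
        (p.2.1 + ∑ i, p.2.2 i)) := by
    refine hf.comp (measurable_pi_lambda _ fun j => Measurable.div (Measurable.add (by fun_prop)
      (Finset.measurable_sum _ fun i _ => ?_)) (by fun_prop))
    split_ifs <;> fun_prop
  rw [← Measure.prodAssoc_prod, lintegral_map hm (MeasurableEquiv.measurable _)]
  refine Eq.trans ?_ (lintegral_prod_symm _
    (hm.comp (MeasurableEquiv.measurable _)).aemeasurable).symm
  refine lintegral_congr fun e => ?_
  simp only [Function.comp, MeasurableEquiv.prodAssoc, MeasurableEquiv.coe_mk,
    Equiv.prodAssoc_apply]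
  rw [lintegral_dirichlet_prod_gammaLaw ha]
  · refine lintegral_congr_ae ?_
    filter_upwards [gammaPi_nonneg ha] with g hg
    congr 1
    ext j
    rw [hcancel g hg]
    congr 1
    rw [Finset.sum_add_distrib, Finset.sum_comm]
    simp
  · refine hf.comp (measurable_pi_lambda _ fun j => ?_)
    fun_prop

end Pi

/-- The moments of a Gamma distribution are positive and finite. -/
lemma lintegral_pow_gammaLaw {a : ℝ} (ha : 0 < a) (n : ℕ) :
    ∫⁻ s, ENNReal.ofReal s ^ n ∂(gammaLaw a) ≠ 0 ∧
      ∫⁻ s, ENNReal.ofReal s ^ n ∂(gammaLaw a) ≠ ∞ := by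
  induction n generalizing a with
  | zero =>
    have := isProbabilityMeasure_gammaLaw ha.le
    simp
  | succ n ih =>
    have h : ∫⁻ s, ENNReal.ofReal s ^ (n + 1) ∂(gammaLaw a) =
        ENNReal.ofReal a * ∫⁻ s, ENNReal.ofReal s ^ n ∂(gammaLaw (a + 1)) := by
      rw [← smul_eq_mul, ← lintegral_smul_measure, ← gammaLaw_withDensity ha.le,
        lintegral_withDensity_eq_lintegral_mul _ (by fun_prop) (by fun_prop)]
      simp [pow_succ']
    rw [h]
    obtain ⟨h1, h2⟩ := ih (a := a + 1) (by linarith)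
    exact ⟨mul_ne_zero (by simpa using ha) h1, ENNReal.mul_ne_top ENNReal.ofReal_ne_top h2⟩

/-! ### Measurability of normalized random measures -/

lemma measurable_asProb {X : Type*} [MeasurableSpace X] [Nonempty X] :
    Measurable (asProb : Measure X → ProbabilityMeasure X) := by
  classical
  refine Measurable.subtype_mk (f := fun m => ((asProb m : ProbabilityMeasure X) : Measure X))
    (p := fun m => IsProbabilityMeasure m) (h := fun m => (asProb m).2) ?_
  have : (fun m : Measure X => ((asProb m : ProbabilityMeasure X) : Measure X)) =
      fun m => if m ∈ {m | IsProbabilityMeasure m} then m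
        else Measure.dirac (Classical.arbitrary X) := by
    ext1 m
    unfold asProb
    by_cases h : IsProbabilityMeasure m <;> simp [h]
  rw [this]
  exact Measurable.ite ProbabilityMeasure.measurableSet_isProbabilityMeasure measurable_id
    measurable_const

lemma coe_asProb {X : Type*} [MeasurableSpace X] [Nonempty X] (m : Measure X)
    [hm : IsProbabilityMeasure m] : (asProb m : Measure X) = m := by
  simp [asProb, hm]

/-- The total-mass normalization of a measure. -/
noncomputable def normalize {X : Type*} [MeasurableSpace X] [Nonempty X] (m : Measure X) :
    ProbabilityMeasure X :=
  asProb ((m Set.univ)⁻¹ • m)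

lemma measurable_measure_smul {Y X : Type*} [MeasurableSpace Y] [MeasurableSpace X]
    {f : Y → ℝ≥0∞} {m : Y → Measure X} (hf : Measurable f) (hm : Measurable m) :
    Measurable fun y => f y • m y := by
  refine Measure.measurable_of_measurable_coe _ fun s hs => ?_
  simp only [Measure.smul_apply, smul_eq_mul]
  exact hf.mul ((Measure.measurable_coe hs).comp hm)

lemma measurable_measure_sum {Y X I : Type*} [MeasurableSpace Y] [MeasurableSpace X] [Fintype I]
    {m : I → Y → Measure X} (hm : ∀ i, Measurable (m i)) :
    Measurable fun y => ∑ i, m i y := by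
  refine Measure.measurable_of_measurable_coe _ fun s hs => ?_
  simp only [Measure.coe_finsetSum, Finset.sum_apply]
  exact Finset.measurable_sum _ fun i _ => (Measure.measurable_coe hs).comp (hm i)

lemma measurable_measure_add {Y X : Type*} [MeasurableSpace Y] [MeasurableSpace X]
    {m m' : Y → Measure X} (hm : Measurable m) (hm' : Measurable m') :
    Measurable fun y => m y + m' y := by
  refine Measure.measurable_of_measurable_coe _ fun s hs => ?_
  simp only [Measure.coe_add, Pi.add_apply]
  exact ((Measure.measurable_coe hs).comp hm).add ((Measure.measurable_coe hs).comp hm')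

lemma measurable_normalize_measure {X : Type*} [MeasurableSpace X] [Nonempty X] :
    Measurable (normalize : Measure X → ProbabilityMeasure X) :=
  measurable_asProb.comp (measurable_measure_smul
    (Measure.measurable_coe MeasurableSet.univ).inv measurable_id)

lemma coe_normalize {X : Type*} [MeasurableSpace X] [Nonempty X] {m : Measure X}
    (h0 : m Set.univ ≠ 0) (ht : m Set.univ ≠ ∞) :
    (normalize m : Measure X) = (m Set.univ)⁻¹ • m := by
  have : IsProbabilityMeasure ((m Set.univ)⁻¹ • m) :=
    ⟨by simp [ENNReal.inv_mul_cancel h0 ht]⟩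
  exact coe_asProb _

lemma normalize_smul {X : Type*} [MeasurableSpace X] [Nonempty X] (m : Measure X) {c : ℝ≥0∞}
    (h0 : c ≠ 0) (ht : c ≠ ∞) : normalize (c • m) = normalize m := by
  unfold normalize
  congr 1
  rw [Measure.smul_apply, smul_eq_mul, ENNReal.mul_inv (Or.inl h0) (Or.inl ht), smul_smul,
    mul_right_comm, ENNReal.inv_mul_cancel h0 ht, one_mul]

/-! ### The posterior of a Dirichlet process -/

section Posterior

variable {C : Type*} [MeasurableSpace C]

/-- The unnormalized posterior draw `s P + ∑ i, e i δ_{c i}`, where `ω = (P, s, e)`. -/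
noncomputable def rawDraw {n : ℕ} (c : Fin n → C) (ω : ProbabilityMeasure C × ℝ × (Fin n → ℝ)) :
    Measure C :=
  ENNReal.ofReal ω.2.1 • (ω.1 : Measure C) + ∑ i, ENNReal.ofReal (ω.2.2 i) • Measure.dirac (c i)

/-- For `P ∼ DP(Q, α)`, `s ∼ Gamma(α, 1)` and i.i.d. standard exponential `e i`, all independent,
the normalization of `s P + ∑ i, e i δ_{c i}` has law `DP(α Q + ∑ i, δ_{c i})`, the posterior of
the Dirichlet process given the observations `c i`. -/
noncomputable def postDraw [Nonempty C] {n : ℕ} (c : Fin n → C)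
    (ω : ProbabilityMeasure C × ℝ × (Fin n → ℝ)) : ProbabilityMeasure C :=
  normalize (rawDraw c ω)

/-- The law of the ingredients `(P, s, e)` of `postDraw`. -/
noncomputable def drawLaw (D : Measure (ProbabilityMeasure C)) (α : ℝ) (n : ℕ) :
    Measure (ProbabilityMeasure C × ℝ × (Fin n → ℝ)) :=
  D.prod ((gammaLaw α).prod (gammaPi fun _ => 1))

lemma isProbabilityMeasure_drawLaw (D : Measure (ProbabilityMeasure C)) [IsProbabilityMeasure D]
    {α : ℝ} (hα : 0 < α) (n : ℕ) : IsProbabilityMeasure (drawLaw D α n) := by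
  have := isProbabilityMeasure_gammaLaw hα.le
  unfold drawLaw; infer_instance

lemma measurable_rawDraw {n : ℕ} :
    Measurable fun p : (Fin n → C) × (ProbabilityMeasure C × ℝ × (Fin n → ℝ)) =>
      rawDraw p.1 p.2 := by
  refine measurable_measure_add (measurable_measure_smul (by fun_prop)
    (measurable_subtype_coe.comp (by fun_prop))) (measurable_measure_sum fun i =>
      measurable_measure_smul (by fun_prop) (Measure.measurable_dirac.comp (by fun_prop)))

lemma measurable_postDraw [Nonempty C] {n : ℕ} :
    Measurable fun p : (Fin n → C) × (ProbabilityMeasure C × ℝ × (Fin n → ℝ)) =>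
      postDraw p.1 p.2 :=
  measurable_normalize_measure.comp measurable_rawDraw

lemma drawLaw_pos (D : Measure (ProbabilityMeasure C)) [IsProbabilityMeasure D]
    {α : ℝ} (hα : 0 < α) (n : ℕ) :
    ∀ᵐ ω ∂(drawLaw D α n), 0 < ω.2.1 ∧ ∀ i, 0 < ω.2.2 i := by
  have := isProbabilityMeasure_gammaLaw hα.le
  have h1 : ∀ᵐ p ∂((gammaLaw α).prod (gammaPi fun _ : Fin n => 1)), 0 < p.1 :=
    Measure.quasiMeasurePreserving_fst.ae (gammaLaw_pos hα)
  have h2 : ∀ᵐ p ∂((gammaLaw α).prod (gammaPi fun _ : Fin n => 1)), ∀ i, 0 < p.2 i := by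
    refine Measure.quasiMeasurePreserving_snd.ae (p := fun e : Fin n → ℝ => ∀ i, 0 < e i) ?_
    rw [ae_all_iff]
    intro j
    exact (Measure.quasiMeasurePreserving_eval _ j).ae (gammaLaw_pos one_pos)
  exact Measure.quasiMeasurePreserving_snd.ae (h1.and h2)

lemma rawDraw_univ {n : ℕ} (c : Fin n → C) {ω : ProbabilityMeasure C × ℝ × (Fin n → ℝ)}
    (hs : 0 ≤ ω.2.1) (he : ∀ i, 0 ≤ ω.2.2 i) :
    rawDraw c ω Set.univ = ENNReal.ofReal (ω.2.1 + ∑ i, ω.2.2 i) := by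
  rw [ENNReal.ofReal_add hs (Finset.sum_nonneg fun i _ => he i),
    ENNReal.ofReal_sum_of_nonneg fun i _ => he i]
  simp [rawDraw]

lemma coe_postDraw [Nonempty C] {n : ℕ} (c : Fin n → C)
    {ω : ProbabilityMeasure C × ℝ × (Fin n → ℝ)} (hs : 0 < ω.2.1) (he : ∀ i, 0 ≤ ω.2.2 i) :
    (postDraw c ω : Measure C) = (ENNReal.ofReal (ω.2.1 + ∑ i, ω.2.2 i))⁻¹ • rawDraw c ω := by
  have hpos : 0 < ω.2.1 + ∑ i, ω.2.2 i :=
    add_pos_of_pos_of_nonneg hs (Finset.sum_nonneg fun i _ => he i)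
  rw [postDraw, coe_normalize, rawDraw_univ c hs.le he]
  · rw [rawDraw_univ c hs.le he]; simpa using hpos
  · rw [rawDraw_univ c hs.le he]; exact ENNReal.ofReal_ne_top

/-- The vector of the probabilities of the cells `q ⁻¹' {j}` of a partition. -/
noncomputable def cellProbs {J : Type*} (q : C → J) (P : ProbabilityMeasure C) (j : J) : ℝ :=
  (P : Measure C).real (q ⁻¹' {j})

lemma measurable_cellProbs {J : Type*} {q : C → J} (hq : ∀ j, MeasurableSet (q ⁻¹' {j})) :
    Measurable (cellProbs q) :=
  measurable_pi_lambda _ fun j =>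
    ((Measure.measurable_coe (hq j)).comp measurable_subtype_coe).ennreal_toReal

lemma cellProbs_postDraw [Nonempty C] {J : Type*} [DecidableEq J] {q : C → J} {n : ℕ}
    (c : Fin n → C) {ω : ProbabilityMeasure C × ℝ × (Fin n → ℝ)} (hs : 0 < ω.2.1)
    (he : ∀ i, 0 ≤ ω.2.2 i) (j : J)
    (hj : MeasurableSet (q ⁻¹' {j})) :
    cellProbs q (postDraw c ω) j =
      (ω.2.1 * cellProbs q ω.1 j + ∑ i, if q (c i) = j then ω.2.2 i else 0) /
        (ω.2.1 + ∑ i, ω.2.2 i) := by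
  have hpos : 0 < ω.2.1 + ∑ i, ω.2.2 i :=
    add_pos_of_pos_of_nonneg hs (Finset.sum_nonneg fun i _ => he i)
  rw [cellProbs, coe_postDraw c hs he, measureReal_def, Measure.smul_apply, smul_eq_mul,
    ENNReal.toReal_mul,
    ENNReal.toReal_inv, ENNReal.toReal_ofReal hpos.le, div_eq_inv_mul]
  congr 1
  simp only [cellProbs, measureReal_def, rawDraw, Measure.coe_add, Pi.add_apply,
    Measure.smul_apply, smul_eq_mul, Measure.coe_finsetSum, Finset.sum_apply,
    Measure.dirac_apply' _ hj]
  rw [ENNReal.toReal_add, ENNReal.toReal_mul, ENNReal.toReal_ofReal hs.le, ENNReal.toReal_sum]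
  · congr 1
    refine Finset.sum_congr rfl fun i _ => ?_
    rw [ENNReal.toReal_mul, ENNReal.toReal_ofReal (he i)]
    by_cases h : q (c i) = j <;> simp [h, Set.indicator]
  · intro i _
    refine ENNReal.mul_ne_top ENNReal.ofReal_ne_top ?_
    by_cases h : q (c i) = j <;> simp [h, Set.indicator]
  · exact ENNReal.mul_ne_top ENNReal.ofReal_ne_top (measure_ne_top _ _)
  · refine ENNReal.sum_ne_top.2 fun i _ => ENNReal.mul_ne_top ENNReal.ofReal_ne_top ?_
    by_cases h : q (c i) = j <;> simp [h, Set.indicator]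

lemma IsDirichletProcess.map_cellProbs {Q : Measure C} {α : ℝ}
    {D : Measure (ProbabilityMeasure C)} (h : IsDirichletProcess Q α D) (hα : 0 < α)
    {J : Type*} [Fintype J] {q : C → J} (hq : ∀ j, MeasurableSet (q ⁻¹' {j})) :
    D.map (cellProbs q) =
      dirichlet fun j => α * Q.real (q ⁻¹' {j}) := by
  let e := Fintype.equivFin J
  have h1 := h.map_partition (Fintype.card J) (fun r => q ⁻¹' {e.symm r}) (fun r => hq _)
    (fun r s hrs => by
      refine Disjoint.preimage q ?_
      simpa using hrs)
    (by
      ext x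
      simpa using ⟨e (q x), by simp⟩)
  have h2 := map_comp_dirichlet (a := fun r => α * Q.real (q ⁻¹' {e.symm r}))
    (fun r => by positivity) e
  have hm : Measurable fun (P : ProbabilityMeasure C) r =>
      (P : Measure C).real (q ⁻¹' {e.symm r}) :=
    measurable_pi_lambda _ fun r => (measurable_pi_apply (e.symm r)).comp (measurable_cellProbs hq)
  rw [← h1, Measure.map_map (by fun_prop) hm] at h2
  simp only [Equiv.symm_apply_apply] at h2
  rw [← h2]
  congr 1
  ext P j
  simp [cellProbs]

/-- The law of `(P, c)` for `P ∼ DP(Q, α)` and `c i` i.i.d. from `P`, on events determined by the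
cells of a finite measurable partition when the `c i` lie in different cells. -/
lemma IsDirichletProcess.compProd_apply_cells [Nonempty C] {Q : Measure C}
    [IsProbabilityMeasure Q] {α : ℝ} {D : Measure (ProbabilityMeasure C)}
    (h : IsDirichletProcess Q α D) (hα : 0 < α)
    {J : Type*} [Fintype J] [DecidableEq J] {q : C → J} (hq : ∀ j, MeasurableSet (q ⁻¹' {j}))
    {n : ℕ} {r : Fin n → J} (hr : Function.Injective r) {B : Set (J → ℝ)} (hB : MeasurableSet B) :
    (∫⁻ s, ENNReal.ofReal s ^ n ∂(gammaLaw α)) * (D ⊗ₘ iidKernel C n)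
      ((cellProbs q ⁻¹' B) ×ˢ
        {c | ∀ i, q (c i) = r i}) =
    ENNReal.ofReal α ^ n * (((Measure.pi fun _ => Q).prod (drawLaw D α n)).map
      fun p => (postDraw p.1 p.2, p.1))
      ((cellProbs q ⁻¹' B) ×ˢ
        {c | ∀ i, q (c i) = r i}) := by
  have := h.isProbabilityMeasure
  have := isProbabilityMeasure_drawLaw D hα n
  have := isProbabilityMeasure_gammaLaw hα.le
  have hEB : MeasurableSet
      (cellProbs q ⁻¹' B) :=
    measurable_cellProbs hq hB
  have hcells : {c : Fin n → C | ∀ i, q (c i) = r i} =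
      Set.univ.pi fun i => q ⁻¹' {r i} := by ext c; simp
  have hEc : MeasurableSet {c : Fin n → C | ∀ i, q (c i) = r i} := by
    rw [hcells]; exact MeasurableSet.univ_pi fun i => hq _
  have hdn : ∀ j, 0 ≤ α * Q.real (q ⁻¹' {j}) := fun j => by positivity
  have hsum : ∑ j, α * Q.real (q ⁻¹' {j}) = α := by
    have : ∑ j, Q.real (q ⁻¹' {j}) = 1 := by
      have := sum_measureReal_preimage_singleton (μ := Q) (f := q) Finset.univ (fun j _ => hq j)
      simpa using this
    rw [← Finset.mul_sum, this, mul_one]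
  let f : (J → ℝ) → ℝ≥0∞ := B.indicator 1
  have hf : Measurable f := measurable_one.indicator hB
  have hmain := lintegral_prod_mul_dirichlet hdn hr hf
  rw [hsum, ← h.map_cellProbs hα hq] at hmain
  have lhs : (D ⊗ₘ iidKernel C n)
      ((cellProbs q ⁻¹' B) ×ˢ
        {c | ∀ i, q (c i) = r i}) =
      ∫⁻ y, (∏ i, ENNReal.ofReal (y (r i))) * f y
        ∂(D.map (cellProbs q)) := by
    rw [lintegral_map (by fun_prop) (measurable_cellProbs hq),
      Measure.compProd_apply_prod hEB hEc, ← lintegral_indicator hEB]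
    refine lintegral_congr fun P => ?_
    have : iidKernel C n P {c | ∀ i, q (c i) = r i} =
        ∏ i, ENNReal.ofReal (cellProbs q P (r i)) := by
      change (Measure.pi fun _ => (P : Measure C)) _ = _
      rw [hcells, Measure.pi_pi]
      simp [cellProbs]
    by_cases hP : cellProbs q P ∈ B
    · simp [Set.indicator, hP, this, f]
    · simp [Set.indicator, hP, f]
  have rhs : (((Measure.pi fun _ => Q).prod (drawLaw D α n)).map
      fun p => (postDraw p.1 p.2, p.1))
      ((cellProbs q ⁻¹' B) ×ˢ
        {c | ∀ i, q (c i) = r i}) = (∏ i, Q (q ⁻¹' {r i})) *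
      ∫⁻ ω, f (fun j => (ω.2.1 * cellProbs q ω.1 j +
        ∑ i, if r i = j then ω.2.2 i else 0) / (ω.2.1 + ∑ i, ω.2.2 i)) ∂(drawLaw D α n) := by
    have hm : Measurable fun p : (Fin n → C) × (ProbabilityMeasure C × ℝ × (Fin n → ℝ)) =>
        (postDraw p.1 p.2, p.1) := measurable_postDraw.prodMk measurable_fst
    rw [Measure.map_apply hm (hEB.prod hEc), Measure.prod_apply (hm (hEB.prod hEc))]
    have : ∏ i, Q (q ⁻¹' {r i}) = (Measure.pi fun _ => Q) {c | ∀ i, q (c i) = r i} := by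
      rw [hcells, Measure.pi_pi]
    rw [this, mul_comm, ← lintegral_indicator_const hEc]
    refine lintegral_congr fun c => ?_
    by_cases hc : ∀ i, q (c i) = r i
    · rw [Set.indicator_of_mem (by exact hc), ← lintegral_indicator_one
        (measurable_prodMk_left (hm (hEB.prod hEc)))]
      refine lintegral_congr_ae ?_
      filter_upwards [drawLaw_pos D hα n] with ω hω
      have e : cellProbs q (postDraw c ω) =
          fun j => (ω.2.1 * cellProbs q ω.1 j +
            ∑ i, if r i = j then ω.2.2 i else 0) / (ω.2.1 + ∑ i, ω.2.2 i) := by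
        ext j
        rw [cellProbs_postDraw c hω.1 (fun i => (hω.2 i).le) j (hq j)]
        simp [hc]
      rw [← e]
      by_cases hB' : cellProbs q (postDraw c ω) ∈ B
      · exact (Set.indicator_of_mem (by exact ⟨hB', hc⟩) _).trans
          (Set.indicator_of_mem hB' 1).symm
      · exact (Set.indicator_of_notMem (by exact fun h => hB' h.1) _).trans
          (Set.indicator_of_notMem hB' 1).symm
    · rw [Set.indicator_of_notMem (by exact hc)]
      convert measure_empty (μ := drawLaw D α n)
      ext ω
      simp only [Set.mem_preimage, Set.mem_prod, Set.mem_ofPred_eq, Set.mem_empty_iff_false,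
        iff_false, not_and]
      exact fun _ => hc
  rw [lhs, rhs, hmain]
  have hprod : (∏ i, ENNReal.ofReal (α * Q.real (q ⁻¹' {r i}))) =
      ENNReal.ofReal α ^ n * ∏ i, Q (q ⁻¹' {r i}) := by
    rw [← Fin.prod_const, ← Finset.prod_mul_distrib]
    refine Finset.prod_congr rfl fun i _ => ?_
    rw [ENNReal.ofReal_mul hα.le, ofReal_measureReal]
  rw [hprod, mul_assoc]
  congr 2
  have hmap : (D.map (cellProbs q)).prod
      ((gammaLaw α).prod (gammaPi fun _ : Fin n => 1)) = (drawLaw D α n).map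
        (Prod.map (cellProbs q) id) := by
    rw [drawLaw, ← Measure.map_prod_map _ _ (measurable_cellProbs hq) measurable_id, Measure.map_id]
  rw [hmap, lintegral_map _ ((measurable_cellProbs hq).prodMap measurable_id)]
  · rfl
  · refine hf.comp (measurable_pi_lambda _ fun j => Measurable.div (Measurable.add (by fun_prop)
      (Finset.measurable_sum _ fun i _ => ?_)) (by fun_prop))
    split_ifs <;> fun_prop

end Posterior

/-! ### Refining finite partitions of the sample space -/

section Partition

variable (C : Type*) [MeasurableSpace C] [MeasurableSpace.CountablyGenerated C]

/-- The cell of a point in the finite partition generated by the first `m` sets of a countable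
family generating the `σ`-algebra. -/
noncomputable def cell (m : ℕ) (c : C) (k : Fin m) : Bool :=
  MeasurableSpace.mapNatBool C c k

variable {C}

lemma measurableSet_cell (m : ℕ) (j : Fin m → Bool) : MeasurableSet (cell C m ⁻¹' {j}) := by
  have : Measurable (cell C m) := measurable_pi_lambda _ fun k =>
    (measurable_pi_apply (k : ℕ)).comp (MeasurableSpace.measurable_mapNatBool C)
  exact this (measurableSet_singleton j)

lemma cell_castLE {m M : ℕ} (h : m ≤ M) (c : C) :
    cell C m c = fun k => cell C M c (Fin.castLE h k) := rfl

lemma measurableSpace_eq_generateFrom_cell :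
    ‹MeasurableSpace C› = MeasurableSpace.generateFrom
      {s | ∃ (m : ℕ) (j : Fin m → Bool), s = cell C m ⁻¹' {j}} := by
  refine le_antisymm ?_ (MeasurableSpace.generateFrom_le ?_)
  · conv_lhs => rw [← MeasurableSpace.generateFrom_natGeneratingSequence C]
    refine MeasurableSpace.generateFrom_le ?_
    rintro _ ⟨k, rfl⟩
    have : MeasurableSpace.natGeneratingSequence C k =
        ⋃ j ∈ {j : Fin (k + 1) → Bool | j (Fin.last k) = true}, cell C (k + 1) ⁻¹' {j} := by
      ext c
      simp [cell, MeasurableSpace.mapNatBool]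
    rw [this]
    refine MeasurableSet.biUnion (Set.to_countable _) fun j _ => ?_
    exact MeasurableSpace.measurableSet_generateFrom ⟨k + 1, j, rfl⟩
  · rintro _ ⟨m, j, rfl⟩
    exact measurableSet_cell m j

lemma isPiSystem_cell : IsPiSystem {s : Set C | ∃ (m : ℕ) (j : Fin m → Bool),
    s = cell C m ⁻¹' {j}} := by
  have key : ∀ {m M : ℕ} (_ : m ≤ M) (j : Fin m → Bool) (j' : Fin M → Bool),
      (cell C m ⁻¹' {j} ∩ cell C M ⁻¹' {j'}).Nonempty →
      cell C m ⁻¹' {j} ∩ cell C M ⁻¹' {j'} = cell C M ⁻¹' {j'} := by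
    rintro m M h j j' ⟨c, hc1, hc2⟩
    refine Set.inter_eq_right.2 fun d hd => ?_
    simp only [Set.mem_preimage, Set.mem_singleton_iff] at *
    rw [cell_castLE h] at hc1 ⊢
    rw [hd, ← hc2, hc1]
  rintro _ ⟨m, j, rfl⟩ _ ⟨m', j', rfl⟩ hne
  rcases le_total m m' with h | h
  · exact ⟨m', j', key h j j' hne⟩
  · rw [Set.inter_comm] at hne ⊢
    exact ⟨m, j, key h j' j hne⟩

/-- Event that the cell probabilities of a random measure lie in `B`, and the points of a sample
in given cells, for the `m`-th partition. -/
def cylinder {n : ℕ} (m : ℕ) (B : Set ((Fin m → Bool) → ℝ)) (z : Fin n → Fin m → Bool) :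
    Set (ProbabilityMeasure C × (Fin n → C)) :=
  (cellProbs (cell C m) ⁻¹' B) ×ˢ {c | ∀ i, cell C m (c i) = z i}

lemma measurableSet_cylinder {n m : ℕ} {B : Set ((Fin m → Bool) → ℝ)} (hB : MeasurableSet B)
    (z : Fin n → Fin m → Bool) : MeasurableSet (cylinder (C := C) m B z) := by
  refine (measurable_cellProbs (measurableSet_cell m) hB).prod ?_
  have : {c : Fin n → C | ∀ i, cell C m (c i) = z i} =
      ⋂ i, (fun c => c i) ⁻¹' (cell C m ⁻¹' {z i}) := by ext; simp
  rw [this]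
  exact MeasurableSet.iInter fun i => measurable_pi_apply i (measurableSet_cell m (z i))

lemma cellProbs_castLE {m M : ℕ} (h : m ≤ M) (P : ProbabilityMeasure C) (j : Fin m → Bool) :
    cellProbs (cell C m) P j =
      ∑ j' with (fun k => j' (Fin.castLE h k)) = j, cellProbs (cell C M) P j' := by
  simp only [cellProbs]
  rw [sum_measureReal_preimage_singleton _ fun j _ => measurableSet_cell M j]
  congr 1
  ext c
  simp [cell_castLE h]

/-- A cell of the finer partition determines the cell of the coarser one, so a nonempty
intersection of two cylinders is a cylinder of the higher level over the same cells. -/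
lemma cylinder_inter {n m M : ℕ} (h : m ≤ M) {B : Set ((Fin m → Bool) → ℝ)} (hB : MeasurableSet B)
    {B' : Set ((Fin M → Bool) → ℝ)} (hB' : MeasurableSet B') (z : Fin n → Fin m → Bool)
    (z' : Fin n → Fin M → Bool)
    (hne : (cylinder (C := C) m B z ∩ cylinder (C := C) M B' z').Nonempty) :
    ∃ B'' : Set ((Fin M → Bool) → ℝ), MeasurableSet B'' ∧
      cylinder (C := C) m B z ∩ cylinder (C := C) M B' z' = cylinder (C := C) M B'' z' := by
  obtain ⟨⟨P₀, c₀⟩, ⟨-, hc1⟩, ⟨-, hc2⟩⟩ := hne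
  let f : ((Fin M → Bool) → ℝ) → (Fin m → Bool) → ℝ :=
    fun y j => ∑ j' with (fun k => j' (Fin.castLE h k)) = j, y j'
  have hf : Measurable f := by fun_prop
  refine ⟨f ⁻¹' B ∩ B', (hf hB).inter hB', ?_⟩
  have hz : ∀ i, z i = fun k => z' i (Fin.castLE h k) := by
    intro i
    rw [← hc1 i, cell_castLE h]
    simp only at hc2
    simp only [hc2 i]
  have hcp : ∀ P : ProbabilityMeasure C,
      cellProbs (cell C m) P = f (cellProbs (cell C M) P) := by
    intro P; ext j; exact cellProbs_castLE h P j
  ext ⟨P, c⟩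
  simp only [cylinder, Set.mem_inter_iff, Set.mem_prod, Set.mem_preimage, Set.mem_ofPred_eq, hcp]
  constructor
  · rintro ⟨⟨h1, -⟩, h2, h3⟩
    exact ⟨⟨h1, h2⟩, h3⟩
  · rintro ⟨⟨h1, h2⟩, h3⟩
    refine ⟨⟨h1, fun i => ?_⟩, h2, h3⟩
    rw [cell_castLE h, h3 i, hz i]

variable (C) in
/-- The cylinders of all levels. -/
def cylinders (n : ℕ) : Set (Set (ProbabilityMeasure C × (Fin n → C))) :=
  {s | ∃ (m : ℕ) (B : Set ((Fin m → Bool) → ℝ)) (z : Fin n → Fin m → Bool),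
    MeasurableSet B ∧ s = cylinder m B z}

lemma isPiSystem_cylinders (n : ℕ) : IsPiSystem (cylinders C n) := by
  rintro _ ⟨m, B, z, hB, rfl⟩ _ ⟨m', B', z', hB', rfl⟩ hne
  rcases le_total m m' with h | h
  · obtain ⟨B'', hB'', e⟩ := cylinder_inter h hB hB' z z' hne
    exact ⟨m', B'', z', hB'', e⟩
  · rw [Set.inter_comm] at hne ⊢
    obtain ⟨B'', hB'', e⟩ := cylinder_inter h hB' hB z' z hne
    exact ⟨m, B'', z, hB'', e⟩

lemma generateFrom_cylinders (n : ℕ) :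
    (inferInstance : MeasurableSpace (ProbabilityMeasure C × (Fin n → C))) =
      MeasurableSpace.generateFrom (cylinders C n) := by
  refine le_antisymm ?_ (MeasurableSpace.generateFrom_le ?_)
  · -- both projections are measurable for the `σ`-algebra generated by the cylinders
    let G := MeasurableSpace.generateFrom (cylinders C n)
    have h1 : @Measurable _ _ G _ (Prod.fst : ProbabilityMeasure C × (Fin n → C) → _) := by
      refine @Measurable.subtype_mk _ _ G _ _ (fun p => (p.1 : Measure C)) ?_ (fun p => p.1.2)
      have hprob : ∀ p : ProbabilityMeasure C × (Fin n → C),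
        IsProbabilityMeasure ((fun p => (p.1 : Measure C)) p) := fun p => p.1.2
      refine @Measurable.measure_of_isPiSystem_of_isProbabilityMeasure _ _ G _ _ hprob _
        measurableSpace_eq_generateFrom_cell isPiSystem_cell ?_
      rintro _ ⟨m, j, rfl⟩
      have hreal : @Measurable _ _ G _ fun p : ProbabilityMeasure C × (Fin n → C) =>
          cellProbs (cell C m) p.1 j := by
        intro s hs
        have : (fun p : ProbabilityMeasure C × (Fin n → C) => cellProbs (cell C m) p.1 j) ⁻¹' s =
            ⋃ z : Fin n → Fin m → Bool, cylinder m ((fun y => y j) ⁻¹' s) z := by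
          ext p
          simp only [cylinder, Set.mem_preimage, Set.mem_iUnion, Set.mem_prod, Set.mem_ofPred_eq,
            exists_and_left, iff_self_and]
          exact fun _ => ⟨fun i => cell C m (p.2 i), fun i => rfl⟩
        rw [this]
        exact @MeasurableSet.iUnion _ _ G _ _ fun z => MeasurableSpace.measurableSet_generateFrom
          ⟨m, _, z, measurable_pi_apply j hs, rfl⟩
      have := @Measurable.ennreal_ofReal _ G _ hreal
      simpa [cellProbs] using this
    have h2 : @Measurable _ _ G _ (Prod.snd : ProbabilityMeasure C × (Fin n → C) → _) := by
      refine @measurable_pi_lambda _ _ _ G _ _ fun i => ?_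
      refine measurable_iff_le_map.2 (measurableSpace_eq_generateFrom_cell.le.trans
        (MeasurableSpace.generateFrom_le ?_))
      rintro _ ⟨m, j, rfl⟩
      have : (fun p : ProbabilityMeasure C × (Fin n → C) => p.2 i) ⁻¹' (cell C m ⁻¹' {j}) =
          ⋃ z ∈ {z : Fin n → Fin m → Bool | z i = j}, cylinder m Set.univ z := by
        ext p
        simp only [cylinder, Set.mem_preimage, Set.mem_iUnion, Set.mem_prod, Set.mem_ofPred_eq,
          Set.mem_univ, true_and, exists_prop, Set.mem_singleton_iff]
        constructor
        · exact fun h => ⟨fun i => cell C m (p.2 i), h, fun i => rfl⟩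
        · rintro ⟨z, rfl, h⟩
          exact h i
      change @MeasurableSet _ G _
      rw [this]
      exact @MeasurableSet.biUnion _ _ G _ _ (Set.to_countable _) fun z _ =>
        MeasurableSpace.measurableSet_generateFrom ⟨m, _, z, MeasurableSet.univ, rfl⟩
    exact sup_le (measurable_iff_comap_le.1 h1) (measurable_iff_comap_le.1 h2)
  · rintro _ ⟨m, B, z, hB, rfl⟩
    exact measurableSet_cylinder hB z

end Partition

/-- The joint law of a draw `P` from the Dirichlet process and of an i.i.d. sample `c` from `P`,
restricted to the event that there are no ties in the sample: up to a constant, `c` is an i.i.d.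
sample from `Q` without ties, and the law of `P` given `c` is that of `postDraw c`. -/
theorem IsDirichletProcess.compProd_restrict_injective {C : Type*} [MeasurableSpace C]
    [MeasurableSpace.CountablyGenerated C] [MeasurableSpace.SeparatesPoints C] [Nonempty C]
    {Q : Measure C} [IsProbabilityMeasure Q]
    {α : ℝ} {D : Measure (ProbabilityMeasure C)} (h : IsDirichletProcess Q α D) (hα : 0 < α)
    (n : ℕ) :
    (∫⁻ s, ENNReal.ofReal s ^ n ∂(gammaLaw α)) •
      (D ⊗ₘ iidKernel C n).restrict {p | Function.Injective p.2} =
    ENNReal.ofReal α ^ n • ((((Measure.pi fun _ => Q).prod (drawLaw D α n)).map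
      fun p => (postDraw p.1 p.2, p.1)).restrict {p | Function.Injective p.2}) := by
  have := h.isProbabilityMeasure
  have := isProbabilityMeasure_drawLaw D hα n
  set μ := (∫⁻ s, ENNReal.ofReal s ^ n ∂(gammaLaw α)) • (D ⊗ₘ iidKernel C n) with hμ
  set ν := ENNReal.ofReal α ^ n • (((Measure.pi fun _ => Q).prod (drawLaw D α n)).map
      fun p => (postDraw p.1 p.2, p.1)) with hν
  have hm : Measurable fun p : (Fin n → C) × (ProbabilityMeasure C × ℝ × (Fin n → ℝ)) =>
      (postDraw p.1 p.2, p.1) := measurable_postDraw.prodMk measurable_fst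
  have : IsFiniteMeasure μ := Measure.smul_finite _ (lintegral_pow_gammaLaw hα n).2
  have : IsFiniteMeasure ν := Measure.smul_finite _ (ENNReal.pow_ne_top ENNReal.ofReal_ne_top)
  rw [← Measure.restrict_smul, ← Measure.restrict_smul, ← hμ, ← hν]
  have heq : ∀ (m : ℕ) (B : Set ((Fin m → Bool) → ℝ)) (z : Fin n → Fin m → Bool),
      MeasurableSet B → Function.Injective z → μ (cylinder m B z) = ν (cylinder m B z) := by
    intro m B z hB hz
    have := h.compProd_apply_cells hα (measurableSet_cell m) hz hB
    rw [hμ, hν, Measure.smul_apply, Measure.smul_apply, smul_eq_mul, smul_eq_mul]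
    exact this
  -- absence of ties is detected by one of the partitions
  have hinj : {p : ProbabilityMeasure C × (Fin n → C) | Function.Injective p.2} =
      ⋃ a : Σ m : ℕ, {z : Fin n → Fin m → Bool // Function.Injective z},
        cylinder a.1 Set.univ a.2.1 := by
    ext ⟨P, c⟩
    simp only [Set.mem_ofPred_eq, cylinder, Set.mem_iUnion, Set.mem_prod, Set.mem_preimage,
      Set.mem_univ, true_and]
    constructor
    · intro hc
      have hk : ∀ p : Fin n × Fin n, ∃ k : ℕ, p.1 ≠ p.2 →
          MeasurableSpace.mapNatBool C (c p.1) k ≠ MeasurableSpace.mapNatBool C (c p.2) k := by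
        intro p
        by_cases hp : p.1 = p.2
        · exact ⟨0, fun h => absurd hp h⟩
        · have : MeasurableSpace.mapNatBool C (c p.1) ≠ MeasurableSpace.mapNatBool C (c p.2) :=
            fun h => hp (hc (MeasurableSpace.injective_mapNatBool C h))
          obtain ⟨k, hk⟩ := Function.ne_iff.1 this
          exact ⟨k, fun _ => hk⟩
      choose k hk using hk
      let m := Finset.univ.sup k + 1
      refine ⟨⟨m, fun i => cell C m (c i), fun i j hij => ?_⟩, fun i => rfl⟩
      by_contra hne
      have hlt : k (i, j) < m := Nat.lt_succ_of_le (Finset.le_sup (Finset.mem_univ (i, j)))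
      exact hk (i, j) hne (congrFun hij ⟨k (i, j), hlt⟩)
    · rintro ⟨⟨m, z, hz⟩, hc⟩ i j hij
      exact hz ((hc i).symm.trans ((congrArg _ hij).trans (hc j)))
  -- on a cylinder over distinct cells, compare the two measures on the cylinders of all levels
  rw [hinj, Measure.restrict_iUnion_congr]
  rintro ⟨m, z, hz⟩
  have hU := measurableSet_cylinder (C := C) (MeasurableSet.univ (α := (Fin m → Bool) → ℝ)) z
  refine ext_of_generate_finite _ (generateFrom_cylinders n) (isPiSystem_cylinders n) ?_ ?_
  · rintro _ ⟨m', B, z', hB, rfl⟩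
    rw [Measure.restrict_apply (measurableSet_cylinder hB z'),
      Measure.restrict_apply (measurableSet_cylinder hB z')]
    rcases Set.eq_empty_or_nonempty (cylinder m' B z' ∩ cylinder (C := C) m Set.univ z)
      with he | hne
    · rw [he]; simp
    rcases le_total m m' with hle | hle
    · have hz' : Function.Injective z' := by
        obtain ⟨⟨P, c⟩, ⟨-, hc1⟩, ⟨-, hc2⟩⟩ := hne
        intro i j hij
        refine hz ?_
        have hc1' : ∀ i, cell C m' (c i) = z' i := hc1
        have hc2' : ∀ i, cell C m (c i) = z i := hc2
        rw [← hc2' i, ← hc2' j, cell_castLE hle, cell_castLE hle, hc1' i, hc1' j, hij]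
      rw [Set.inter_comm] at hne ⊢
      obtain ⟨B'', hB'', e⟩ := cylinder_inter hle MeasurableSet.univ hB z z' hne
      rw [e]
      exact heq _ _ _ hB'' hz'
    · obtain ⟨B'', hB'', e⟩ := cylinder_inter hle hB MeasurableSet.univ z' z hne
      rw [e]
      exact heq _ _ _ hB'' hz
  · rw [Measure.restrict_apply_univ, Measure.restrict_apply_univ]
    exact heq _ _ _ MeasurableSet.univ hz

/-! ### Joint law of the model and the data -/

section Model

variable {C : Type*} [MeasurableSpace C]

lemma measurableSet_injective [StandardBorelSpace C] (n : ℕ) :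
    MeasurableSet {c : Fin n → C | Function.Injective c} := by
  have : {c : Fin n → C | Function.Injective c} =
      ⋂ i, ⋂ j, {c : Fin n → C | c i = c j → i = j} := by
    ext c; simp [Function.Injective]
  rw [this]
  refine MeasurableSet.iInter fun i => MeasurableSet.iInter fun j => ?_
  by_cases h : i = j
  · simp [h]
  · simp only [h, imp_false]
    exact (measurableSet_eq_fun (measurable_pi_apply i) (measurable_pi_apply j)).compl

lemma measurableSet_offDiag [StandardBorelSpace C] : MeasurableSet {p : C × C | p.1 ≠ p.2} :=
  (measurableSet_eq_fun measurable_fst measurable_snd).compl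

/-- The factorial moment measures of a Dirichlet process, off the diagonals, are multiples of
those of `Q`. -/
lemma IsDirichletProcess.lintegral_iid [StandardBorelSpace C] [Nonempty C] {Q : Measure C}
    [IsProbabilityMeasure Q] {α : ℝ} {D : Measure (ProbabilityMeasure C)}
    (h : IsDirichletProcess Q α D) (hα : 0 < α)
    {n : ℕ} {f : (Fin n → C) → ℝ≥0∞} (hf : Measurable f) :
    (∫⁻ s, ENNReal.ofReal s ^ n ∂(gammaLaw α)) *
      ∫⁻ P, ∫⁻ c in {c | Function.Injective c}, f c ∂(Measure.pi fun _ => (P : Measure C)) ∂D =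
    ENNReal.ofReal α ^ n *
      ∫⁻ c in {c | Function.Injective c}, f c ∂(Measure.pi fun _ => Q) := by
  have := h.isProbabilityMeasure
  have := isProbabilityMeasure_drawLaw D hα n
  have hI := measurableSet_injective (C := C) n
  have hI2 : MeasurableSet {p : ProbabilityMeasure C × (Fin n → C) | Function.Injective p.2} :=
    measurable_snd hI
  have hm : Measurable fun p : (Fin n → C) × (ProbabilityMeasure C × ℝ × (Fin n → ℝ)) =>
      (postDraw p.1 p.2, p.1) := measurable_postDraw.prodMk measurable_fst
  have hF : Measurable ({p : ProbabilityMeasure C × (Fin n → C) | Function.Injective p.2}.indicator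
      fun p => f p.2) := (hf.comp measurable_snd).indicator hI2
  have key := congrArg (fun μ => ∫⁻ p, f p.2 ∂μ) (h.compProd_restrict_injective hα n)
  simp only [lintegral_smul_measure, smul_eq_mul] at key
  rw [← lintegral_indicator hI2, ← lintegral_indicator hI2,
    Measure.lintegral_compProd hF, lintegral_map hF hm,
    lintegral_prod _ (Measurable.aemeasurable (by exact hF.comp hm))] at key
  simp_rw [← lintegral_indicator hI]
  refine key.trans (congrArg _ (lintegral_congr fun c => ?_))
  have : ∀ ω, {p : ProbabilityMeasure C × (Fin n → C) | Function.Injective p.2}.indicator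
      (fun p => f p.2) (postDraw c ω, c) = {c | Function.Injective c}.indicator f c :=
    fun ω => rfl
  simp [this]

/-- The mean of the Dirichlet process is `Q`. -/
lemma IsDirichletProcess.lintegral_mean [StandardBorelSpace C] [Nonempty C] {Q : Measure C}
    [IsProbabilityMeasure Q] {α : ℝ} {D : Measure (ProbabilityMeasure C)}
    (h : IsDirichletProcess Q α D) (hα : 0 < α)
    {f : C → ℝ≥0∞} (hf : Measurable f) :
    ∫⁻ P, ∫⁻ c, f c ∂(P : Measure C) ∂D = ∫⁻ c, f c ∂Q := by
  have key := h.lintegral_iid hα (n := 1) (f := fun c => f (c 0)) (by fun_prop)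
  have hI : {c : Fin 1 → C | Function.Injective c} = Set.univ := by
    ext c; simp [Function.injective_of_subsingleton]
  have h1 : ∀ P : Measure C, IsProbabilityMeasure P →
      ∫⁻ c in {c : Fin 1 → C | Function.Injective c}, f (c 0) ∂(Measure.pi fun _ => P) =
        ∫⁻ c, f c ∂P := by
    intro P _
    rw [hI, Measure.restrict_univ, ← lintegral_map hf (measurable_pi_apply 0),
      (measurePreserving_eval (fun _ : Fin 1 => P) 0).map_eq]
  rw [h1 Q inferInstance] at key
  simp_rw [fun P : ProbabilityMeasure C => h1 P P.2] at key
  simp only [pow_one, lintegral_ofReal_gammaLaw hα.le] at key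
  exact (ENNReal.mul_right_inj (by simpa using hα) ENNReal.ofReal_ne_top).1 key

lemma IsDirichletProcess.lintegral_offDiag [StandardBorelSpace C] [Nonempty C] {Q : Measure C}
    [IsProbabilityMeasure Q] {α : ℝ} {D : Measure (ProbabilityMeasure C)}
    (h : IsDirichletProcess Q α D) (hα : 0 < α)
    {f : C × C → ℝ≥0∞} (hf : Measurable f) :
    (∫⁻ s, ENNReal.ofReal s ^ 2 ∂(gammaLaw α)) *
      ∫⁻ P, ∫⁻ p in {p | p.1 ≠ p.2}, f p ∂((P : Measure C).prod (P : Measure C)) ∂D =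
    ENNReal.ofReal α ^ 2 * ∫⁻ p in {p | p.1 ≠ p.2}, f p ∂(Q.prod Q) := by
  have key := h.lintegral_iid hα (n := 2) (f := fun c => f (c 0, c 1)) (by fun_prop)
  have hI : {c : Fin 2 → C | Function.Injective c} =
      (MeasurableEquiv.finTwoArrow (α := C)) ⁻¹' {p | p.1 ≠ p.2} := by
    ext c
    simp only [Set.mem_ofPred_eq, Set.mem_preimage, MeasurableEquiv.finTwoArrow_apply]
    constructor
    · exact fun hc h => absurd (hc h) (by decide)
    · intro hc i j hij
      fin_cases i <;> fin_cases j <;> first | rfl | exact absurd hij hc | exact absurd hij.symm hc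
  have h1 : ∀ P : Measure C, IsProbabilityMeasure P →
      ∫⁻ c in {c : Fin 2 → C | Function.Injective c}, f (c 0, c 1) ∂(Measure.pi fun _ => P) =
        ∫⁻ p in {p | p.1 ≠ p.2}, f p ∂(P.prod P) := by
    intro P _
    rw [hI, ← (measurePreserving_finTwoArrow P).setLIntegral_comp_preimage measurableSet_offDiag hf]
    rfl
  rw [h1 Q inferInstance] at key
  simp_rw [fun P : ProbabilityMeasure C => h1 P P.2] at key
  exact key

variable {H : Type*} [MeasurableSpace H]

/-- The index of the link function and the unobserved points `C_1, …, C_n`, given that the latter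
are pairwise distinct. -/
noncomputable def latentLaw (π : Measure H) (Q : Measure C) (n : ℕ) : Measure (H × (Fin n → C)) :=
  π.prod ((Measure.pi fun _ : Fin n => Q)[|{c | Function.Injective c}])

instance (π : Measure H) [IsProbabilityMeasure π] (Q : Measure C) [IsProbabilityMeasure Q] (n : ℕ) :
    IsFiniteMeasure (latentLaw π Q n) := by
  unfold latentLaw; infer_instance

lemma measurable_addDraw [Nonempty C] {n : ℕ} :
    Measurable fun p : (H × (Fin n → C)) × (ProbabilityMeasure C × ℝ × (Fin n → ℝ)) =>
      ((p.1.1, postDraw p.1.2 p.2), p.1.2) :=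
  (((by fun_prop : Measurable fun p : (H × (Fin n → C)) ×
    (ProbabilityMeasure C × ℝ × (Fin n → ℝ)) => p.1.1)).prodMk
    (measurable_postDraw.comp (measurable_fst.snd.prodMk measurable_snd))).prodMk (by fun_prop)

/-- The unnormalized form of `IsDirichletProcess.modelLaw_eq`. -/
lemma IsDirichletProcess.jointLaw_inter_injective [StandardBorelSpace C] [Nonempty C]
    (π : Measure H) [IsProbabilityMeasure π] {Q : Measure C} [IsProbabilityMeasure Q]
    {α : ℝ} {D : Measure (ProbabilityMeasure C)} (h : IsDirichletProcess Q α D) (hα : 0 < α)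
    (n : ℕ) {s : Set ((H × ProbabilityMeasure C) × (Fin n → C))} (hs : MeasurableSet s) :
    (∫⁻ s, ENNReal.ofReal s ^ n ∂(gammaLaw α)) *
      jointLaw π D n ({ω | Function.Injective ω.2} ∩ s) =
    ENNReal.ofReal α ^ n *
      (((π.prod ((Measure.pi fun _ => Q).restrict {c | Function.Injective c})).prod
        (drawLaw D α n)).map fun p => ((p.1.1, postDraw p.1.2 p.2), p.1.2)) s := by
  have := h.isProbabilityMeasure
  have := isProbabilityMeasure_drawLaw D hα n
  have hI := measurableSet_injective (C := C) n
  have hI2 : MeasurableSet {p : ProbabilityMeasure C × (Fin n → C) | Function.Injective p.2} :=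
    measurable_snd hI
  have hI3 : MeasurableSet
      {ω : (H × ProbabilityMeasure C) × (Fin n → C) | Function.Injective ω.2} :=
    measurable_snd hI
  have hm : Measurable fun p : (Fin n → C) × (ProbabilityMeasure C × ℝ × (Fin n → ℝ)) =>
      (postDraw p.1 p.2, p.1) := measurable_postDraw.prodMk measurable_fst
  have hsec : ∀ t : H, MeasurableSet {p : ProbabilityMeasure C × (Fin n → C) |
      ((t, p.1), p.2) ∈ s} := fun t =>
    (by fun_prop : Measurable fun p : ProbabilityMeasure C × (Fin n → C) => ((t, p.1), p.2)) hs
  have h1 : jointLaw π D n ({ω | Function.Injective ω.2} ∩ s) =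
      ∫⁻ t, ((D ⊗ₘ iidKernel C n).restrict {p | Function.Injective p.2})
        {p | ((t, p.1), p.2) ∈ s} ∂π := by
    rw [jointLaw, Measure.compProd_apply (hI3.inter hs), lintegral_prod _
      (Kernel.measurable_kernel_prodMk_left (hI3.inter hs)).aemeasurable]
    refine lintegral_congr fun t => ?_
    rw [Measure.restrict_apply (hsec t), Measure.compProd_apply ((hsec t).inter hI2),
      Set.inter_comm]
    rfl
  have h2 : (((π.prod ((Measure.pi fun _ => Q).restrict {c | Function.Injective c})).prod
        (drawLaw D α n)).map fun p => ((p.1.1, postDraw p.1.2 p.2), p.1.2)) s =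
      ∫⁻ t, ((((Measure.pi fun _ => Q).prod (drawLaw D α n)).map
        fun p => (postDraw p.1 p.2, p.1)).restrict {p | Function.Injective p.2})
        {p | ((t, p.1), p.2) ∈ s} ∂π := by
    rw [Measure.map_apply measurable_addDraw hs, Measure.prod_apply (measurable_addDraw hs),
      lintegral_prod _ (measurable_measure_prodMk_left (measurable_addDraw hs)).aemeasurable]
    refine lintegral_congr fun t => ?_
    rw [Measure.restrict_apply (hsec t), Measure.map_apply hm ((hsec t).inter hI2),
      Measure.prod_apply (hm ((hsec t).inter hI2)), ← lintegral_indicator hI]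
    refine lintegral_congr fun c => ?_
    by_cases hc : Function.Injective c
    · rw [Set.indicator_of_mem (by exact hc)]
      congr 1
      ext ω
      simp [hc]
    · rw [Set.indicator_of_notMem (by exact hc)]
      symm
      convert measure_empty (μ := drawLaw D α n)
      ext ω
      simp [hc]
  have key := h.compProd_restrict_injective hα n
  rw [h1, h2, ← lintegral_const_mul', ← lintegral_const_mul']
  · refine lintegral_congr fun t => ?_
    have := congrArg (fun μ => μ {p | ((t, p.1), p.2) ∈ s}) key
    simpa only [Measure.smul_apply, smul_eq_mul] using this
  · exact ENNReal.pow_ne_top ENNReal.ofReal_ne_top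
  · exact (lintegral_pow_gammaLaw hα n).2

/-- In the model, the law of the unobserved points given that they are distinct does not depend on
the prior strength `α`, and given these points `P` has the law of `postDraw`. -/
lemma IsDirichletProcess.modelLaw_eq [StandardBorelSpace C] [Nonempty C]
    (π : Measure H) [IsProbabilityMeasure π] {Q : Measure C} [IsProbabilityMeasure Q]
    {α : ℝ} {D : Measure (ProbabilityMeasure C)} (h : IsDirichletProcess Q α D) (hα : 0 < α)
    (n : ℕ) :
    modelLaw π D n = ((latentLaw π Q n).prod (drawLaw D α n)).map
      fun p => ((p.1.1, postDraw p.1.2 p.2), p.1.2) := by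
  have := h.isProbabilityMeasure
  have := isProbabilityMeasure_drawLaw D hα n
  have hI := measurableSet_injective (C := C) n
  have hI3 : MeasurableSet
      {ω : (H × ProbabilityMeasure C) × (Fin n → C) | Function.Injective ω.2} :=
    measurable_snd hI
  obtain ⟨hs0, hst⟩ := lintegral_pow_gammaLaw hα n
  set S := ∫⁻ s, ENNReal.ofReal s ^ n ∂(gammaLaw α)
  set A := ENNReal.ofReal α ^ n with hA
  have hA0 : A ≠ 0 := pow_ne_zero _ (by simpa using hα)
  have hAt : A ≠ ∞ := ENNReal.pow_ne_top ENNReal.ofReal_ne_top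
  set Z := Measure.pi fun _ : Fin n => Q
  have hlat : latentLaw π Q n = (Z {c | Function.Injective c})⁻¹ •
      π.prod (Z.restrict {c | Function.Injective c}) := by
    rw [latentLaw, ProbabilityTheory.cond, Measure.prod_smul_right]
  -- the total mass of the joint law on the event of distinct points
  have hmass : jointLaw π D n {ω | Function.Injective ω.2} =
      S⁻¹ * A * Z {c | Function.Injective c} := by
    have := h.jointLaw_inter_injective π hα n MeasurableSet.univ
    rw [Set.inter_univ, Measure.map_apply measurable_addDraw MeasurableSet.univ,
      Set.preimage_univ, ← Set.univ_prod_univ, Measure.prod_prod, ← Set.univ_prod_univ,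
      Measure.prod_prod, Measure.restrict_apply_univ, measure_univ, measure_univ, one_mul,
      mul_one] at this
    rw [mul_assoc, ← this, ← mul_assoc, ENNReal.inv_mul_cancel hs0 hst, one_mul]
  ext s hs
  have hjoint : jointLaw π D n ({ω | Function.Injective ω.2} ∩ s) =
      S⁻¹ * A * (((π.prod (Z.restrict {c | Function.Injective c})).prod
        (drawLaw D α n)).map fun p => ((p.1.1, postDraw p.1.2 p.2), p.1.2)) s := by
    rw [mul_assoc, ← h.jointLaw_inter_injective π hα n hs, ← mul_assoc,
      ENNReal.inv_mul_cancel hs0 hst, one_mul]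
  have hK0 : S⁻¹ * A ≠ 0 := mul_ne_zero (ENNReal.inv_ne_zero.2 hst) hA0
  have hKt : S⁻¹ * A ≠ ∞ := ENNReal.mul_ne_top (ENNReal.inv_ne_top.2 hs0) hAt
  rw [modelLaw, cond_apply hI3, hmass, hjoint, hlat, Measure.prod_smul_left, Measure.map_smul,
    Measure.smul_apply, smul_eq_mul, ENNReal.mul_inv (Or.inl hK0) (Or.inl hKt), mul_right_comm,
    ← mul_assoc, ENNReal.inv_mul_cancel hK0 hKt, one_mul, mul_comm]

variable {X : Type*} [MeasurableSpace X]

/-- The data as a function of the index of the link function and the unobserved points. -/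
def latentData {n : ℕ} (h : H → C → C → X) (p : H × (Fin n → C)) : DyadicData n X :=
  fun q => h p.1 (p.2 q.1.1) (p.2 q.1.2)

lemma measurable_latentData {n : ℕ} {h : H → C → C → X}
    (hh : Measurable fun p : H × C × C => h p.1 p.2.1 p.2.2) :
    Measurable (latentData h : H × (Fin n → C) → DyadicData n X) :=
  measurable_pi_lambda _ fun q => hh.comp
    (f := fun p : H × (Fin n → C) => (p.1, p.2 q.1.1, p.2 q.1.2)) (by fun_prop)

lemma measurable_data {n : ℕ} {h : H → C → C → X}
    (hh : Measurable fun p : H × C × C => h p.1 p.2.1 p.2.2) :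
    Measurable (data h : (H × ProbabilityMeasure C) × (Fin n → C) → DyadicData n X) :=
  (measurable_latentData hh).comp (f := fun ω : (H × ProbabilityMeasure C) × (Fin n → C) =>
    (ω.1.1, ω.2)) (by fun_prop)

/-- The law of the data does not depend on `α`. -/
lemma IsDirichletProcess.dataLaw_eq [StandardBorelSpace C] [Nonempty C] {π : Measure H}
    [IsProbabilityMeasure π] {Q : Measure C} [IsProbabilityMeasure Q]
    {α : ℝ} {D : Measure (ProbabilityMeasure C)} (hD : IsDirichletProcess Q α D) (hα : 0 < α)
    (n : ℕ) {h : H → C → C → X}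
    (hh : Measurable fun p : H × C × C => h p.1 p.2.1 p.2.2) :
    dataLaw h π D n = (latentLaw π Q n).map (latentData h) := by
  have := hD.isProbabilityMeasure
  have := isProbabilityMeasure_drawLaw D hα n
  rw [dataLaw, hD.modelLaw_eq π hα n, Measure.map_map (measurable_data hh) measurable_addDraw]
  have : (data h ∘ fun p : (H × (Fin n → C)) × (ProbabilityMeasure C × ℝ × (Fin n → ℝ)) =>
      ((p.1.1, postDraw p.1.2 p.2), p.1.2)) = latentData h ∘ Prod.fst := rfl
  rw [this, ← Measure.map_map (measurable_latentData hh) measurable_fst, Measure.map_fst_prod,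
    measure_univ, one_smul]

end Model

/-! ### Stability of normalized measures in weighted total variation -/

/-- Adding to `N` a measure `L` with small weighted mass changes the normalization of `N` only
slightly, in the sense of the distances in `ContinuousAtTV`. -/
lemma normalize_add_close {X : Type*} [MeasurableSpace X] [Nonempty X] {F : X → ℝ≥0}
    {N L : Measure X} (hN0 : N Set.univ ≠ 0) (hNt : N Set.univ ≠ ∞) (hRt : L Set.univ ≠ ∞) {δ : ℝ}
    (h1 : ∫⁻ y, (1 + F y) ∂L ≤ N Set.univ * ENNReal.ofReal δ)
    (h2 : L Set.univ * ∫⁻ y, (1 + F y) ∂(normalize N : Measure X) ≤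
      N Set.univ * ENNReal.ofReal δ) (A : Set X) :
    ∫⁻ y in A, (1 + F y) ∂(normalize (N + L) : Measure X) ≤
        ∫⁻ y in A, (1 + F y) ∂(normalize N : Measure X) + ENNReal.ofReal δ ∧
    ∫⁻ y in A, (1 + F y) ∂(normalize N : Measure X) ≤
        ∫⁻ y in A, (1 + F y) ∂(normalize (N + L) : Measure X) + ENNReal.ofReal δ := by
  have hsum0 : (N + L) Set.univ ≠ 0 := by simp [hN0]
  have hsumt : (N + L) Set.univ ≠ ∞ := by simp [hNt, hRt]
  have hA := setLIntegral_le_lintegral (μ := (normalize N : Measure X)) A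
    (fun y => 1 + (F y : ℝ≥0∞))
  rw [coe_normalize hN0 hNt] at h2 hA ⊢
  rw [coe_normalize hsum0 hsumt]
  simp only [Measure.restrict_smul, lintegral_smul_measure, smul_eq_mul, Measure.restrict_add,
    lintegral_add_measure, Measure.coe_add, Pi.add_apply] at *
  have hRA : ∫⁻ y in A, (1 + F y) ∂L ≤ ∫⁻ y, (1 + F y) ∂L := setLIntegral_le_lintegral _ _
  set m := N Set.univ
  set ρ := L Set.univ
  set NA := ∫⁻ y in A, (1 + (F y : ℝ≥0∞)) ∂N
  set RA := ∫⁻ y in A, (1 + (F y : ℝ≥0∞)) ∂L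
  set d := ENNReal.ofReal δ
  -- `m⁻¹ NA` and `(m + ρ)⁻¹ (NA + RA)` are to be compared
  have hinv : (m + ρ)⁻¹ ≤ m⁻¹ := ENNReal.inv_le_inv.2 le_self_add
  have hmd : m⁻¹ * (m * d) = d := by
    rw [← mul_assoc, ENNReal.inv_mul_cancel hN0 hNt, one_mul]
  constructor
  · calc (m + ρ)⁻¹ * (NA + RA) ≤ m⁻¹ * (NA + RA) := by gcongr
      _ = m⁻¹ * NA + m⁻¹ * RA := mul_add _ _ _
      _ ≤ m⁻¹ * NA + m⁻¹ * (m * d) := by gcongr; exact hRA.trans h1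
      _ = m⁻¹ * NA + d := by rw [hmd]
  · calc m⁻¹ * NA = (m + ρ)⁻¹ * (m + ρ) * (m⁻¹ * NA) := by
          rw [ENNReal.inv_mul_cancel hsum0 hsumt, one_mul]
      _ = (m + ρ)⁻¹ * ((m⁻¹ * m) * NA) + (m + ρ)⁻¹ * (ρ * (m⁻¹ * NA)) := by ring
      _ ≤ (m + ρ)⁻¹ * (NA + RA) + m⁻¹ * (m * d) := by
          rw [ENNReal.inv_mul_cancel hN0 hNt, one_mul]
          refine add_le_add ?_ (mul_le_mul' hinv ((mul_le_mul_right hA ρ).trans h2))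
          gcongr
          exact le_self_add
      _ = _ := by rw [hmd]

/-! ### Laws of dyads as normalized product measures -/

section Dyad

variable {C X : Type*} [MeasurableSpace C] [MeasurableSpace X]

/-- The image under `f` of the product measure `M ⊗ M` off the diagonal. -/
noncomputable def pairMeasure (f : C → C → X) (M : Measure C) : Measure X :=
  ((M.prod M).restrict {p | p.1 ≠ p.2}).map fun p => f p.1 p.2

lemma pairMeasure_univ {f : C → C → X} (hf : Measurable fun p : C × C => f p.1 p.2)
    (M : Measure C) : pairMeasure f M Set.univ = (M.prod M) {p | p.1 ≠ p.2} := by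
  rw [pairMeasure, Measure.map_apply hf MeasurableSet.univ, Set.preimage_univ,
    Measure.restrict_apply_univ]

lemma dyadLaw_eq [Nonempty X] {f : C → C → X} (hf : Measurable fun p : C × C => f p.1 p.2)
    (P : ProbabilityMeasure C) : dyadLaw f P = normalize (pairMeasure f (P : Measure C)) := by
  rw [dyadLaw, normalize, pairMeasure_univ hf, pairMeasure, ProbabilityTheory.cond,
    Measure.map_smul]

lemma measurable_dyadLaw [StandardBorelSpace C] [Nonempty X] {H : Type*} [MeasurableSpace H]
    {h : H → C → C → X} (hh : Measurable fun p : H × C × C => h p.1 p.2.1 p.2.2) :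
    Measurable fun p : H × ProbabilityMeasure C => dyadLaw (h p.1) p.2 := by
  have hf : ∀ t, Measurable fun p : C × C => h t p.1 p.2 := fun t =>
    hh.comp measurable_prodMk_left
  simp_rw [fun p : H × ProbabilityMeasure C => dyadLaw_eq (hf p.1) p.2]
  refine measurable_normalize_measure.comp (Measure.measurable_of_measurable_coe _ fun s hs => ?_)
  let κ : Kernel (H × ProbabilityMeasure C) (C × C) :=
    ⟨fun p => (p.2 : Measure C).prod (p.2 : Measure C),
      (ProbabilityMeasure.measurable_fun_prod (α := C) (β := C)).comp
        (f := fun p : H × ProbabilityMeasure C => (p.2, p.2)) (by fun_prop)⟩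
  have hκ : IsMarkovKernel κ := ⟨fun p => by
    change IsProbabilityMeasure ((p.2 : Measure C).prod (p.2 : Measure C)); infer_instance⟩
  have hE : MeasurableSet {z : (H × ProbabilityMeasure C) × (C × C) |
      h z.1.1 z.2.1 z.2.2 ∈ s ∧ z.2.1 ≠ z.2.2} :=
    ((hh.comp (f := fun z : (H × ProbabilityMeasure C) × (C × C) => (z.1.1, z.2.1, z.2.2))
      (by fun_prop)) hs).inter (measurable_snd measurableSet_offDiag)
  have := Kernel.measurable_kernel_prodMk_left (κ := κ) hE
  convert this using 2 with p
  rw [pairMeasure, Measure.map_apply (hf p.1) hs, Measure.restrict_apply (hf p.1 hs)]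
  rfl

lemma pairMeasure_smul {f : C → C → X} {M : Measure C} [SFinite M] (k : ℝ≥0∞) :
    pairMeasure f (k • M) = (k * k) • pairMeasure f M := by
  rw [pairMeasure, Measure.prod_smul_left, Measure.prod_smul_right, Measure.restrict_smul,
    Measure.restrict_smul, Measure.map_smul, Measure.map_smul, smul_smul, pairMeasure]

/-- The discrete measure `∑ i, e i δ_{c i}`. -/
noncomputable def atoms {n : ℕ} (c : Fin n → C) (e : Fin n → ℝ) : Measure C :=
  ∑ i, ENNReal.ofReal (e i) • Measure.dirac (c i)

instance {n : ℕ} (c : Fin n → C) (e : Fin n → ℝ) : IsFiniteMeasure (atoms c e) := by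
  have : ∀ i, IsFiniteMeasure (ENNReal.ofReal (e i) • Measure.dirac (c i)) :=
    fun i => Measure.smul_finite _ ENNReal.ofReal_ne_top
  unfold atoms
  infer_instance

lemma lintegral_atoms {n : ℕ} (c : Fin n → C) (e : Fin n → ℝ) {g : C → ℝ≥0∞} (hg : Measurable g) :
    ∫⁻ y, g y ∂(atoms c e) = ∑ i, ENNReal.ofReal (e i) * g (c i) := by
  rw [atoms, lintegral_finsetSum_measure]
  refine Finset.sum_congr rfl fun i _ => ?_
  rw [lintegral_smul_measure, lintegral_dirac' _ hg, smul_eq_mul]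

/-- The image of the off-diagonal pairs of atoms is the unnormalized weighted empirical measure of
the data. -/
lemma pairMeasure_atoms [StandardBorelSpace C] {f : C → C → X}
    (hf : Measurable fun p : C × C => f p.1 p.2) {n : ℕ}
    {c : Fin n → C} (hc : Function.Injective c) {e : Fin n → ℝ} (he : ∀ i, 0 ≤ e i) :
    pairMeasure f (atoms c e) = ∑ q : {p : Fin n × Fin n // p.1 ≠ p.2},
      ENNReal.ofReal (e q.1.1 * e q.1.2) • Measure.dirac (f (c q.1.1) (c q.1.2)) := by
  ext s hs
  have hE : MeasurableSet ((fun p : C × C => f p.1 p.2) ⁻¹' s ∩ {p | p.1 ≠ p.2}) :=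
    (hf hs).inter measurableSet_offDiag
  rw [pairMeasure, Measure.map_apply hf hs, Measure.restrict_apply (hf hs),
    Measure.prod_apply hE, lintegral_atoms _ _ (measurable_measure_prodMk_left hE)]
  have h1 : ∀ k, atoms c e (Prod.mk (c k) ⁻¹'
      ((fun p : C × C => f p.1 p.2) ⁻¹' s ∩ {p | p.1 ≠ p.2})) =
      ∑ l, ENNReal.ofReal (e l) * (if k ≠ l then s.indicator 1 (f (c k) (c l)) else 0) := by
    intro k
    rw [← lintegral_indicator_one (measurable_prodMk_left hE), lintegral_atoms _ _
      (measurable_one.indicator (measurable_prodMk_left hE))]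
    refine Finset.sum_congr rfl fun l _ => ?_
    congr 1
    by_cases hkl : k = l
    · subst hkl; simp [Set.indicator]
    · have : c k ≠ c l := fun h => hkl (hc h)
      have hmem : c l ∈ Prod.mk (c k) ⁻¹' ((fun p : C × C => f p.1 p.2) ⁻¹' s ∩
          {p | p.1 ≠ p.2}) ↔ f (c k) (c l) ∈ s := ⟨fun h => h.1, fun h => ⟨h, this⟩⟩
      by_cases hs' : f (c k) (c l) ∈ s
      · rw [Set.indicator_of_mem (hmem.2 hs'), if_pos hkl, Set.indicator_of_mem hs']
        rfl
      · rw [Set.indicator_of_notMem (fun h => hs' (hmem.1 h)), if_pos hkl,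
          Set.indicator_of_notMem hs']
  simp_rw [h1, Finset.mul_sum]
  rw [← Fintype.sum_prod_type' (f := fun k l => ENNReal.ofReal (e k) * (ENNReal.ofReal (e l) *
    (if k ≠ l then s.indicator 1 (f (c k) (c l)) else 0)))]
  simp only [Measure.coe_finsetSum, Finset.sum_apply, Measure.smul_apply, smul_eq_mul,
    Measure.dirac_apply' _ hs]
  rw [← Finset.sum_subtype (Finset.univ.filter fun p : Fin n × Fin n => p.1 ≠ p.2) (by simp)
    (fun p => ENNReal.ofReal (e p.1 * e p.2) * s.indicator 1 (f (c p.1) (c p.2))),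
    Finset.sum_filter]
  refine Finset.sum_congr rfl fun p _ => ?_
  split_ifs with h
  · rw [ENNReal.ofReal_mul (he _), mul_assoc]
  · simp

lemma offDiag_sum_pos {n : ℕ} (hn : 2 ≤ n) {e : Fin n → ℝ} (he : ∀ i, 0 < e i) :
    0 < ∑ q : {p : Fin n × Fin n // p.1 ≠ p.2}, e q.1.1 * e q.1.2 := by
  refine Finset.sum_pos (fun q _ => mul_pos (he _) (he _))
    ⟨⟨(⟨0, by omega⟩, ⟨1, by omega⟩), ?_⟩, ?_⟩
  · simp
  · simp

lemma weightedEmpirical_normalize [Nonempty X] {n : ℕ} (hn : 2 ≤ n) (x : DyadicData n X)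
    {e : Fin n → ℝ} (he : ∀ i, 0 < e i) :
    weightedEmpirical x (fun i => e i / ∑ j, e j) =
      normalize (∑ q : {p : Fin n × Fin n // p.1 ≠ p.2},
        ENNReal.ofReal (e q.1.1 * e q.1.2) • Measure.dirac (x q)) := by
  have hpos := offDiag_sum_pos hn he
  have hS : 0 < ∑ j, e j := Finset.sum_pos (fun i _ => he i) ⟨⟨0, by omega⟩, by simp⟩
  rw [weightedEmpirical, normalize]
  congr 1
  have hmass : (∑ q : {p : Fin n × Fin n // p.1 ≠ p.2},
      ENNReal.ofReal (e q.1.1 * e q.1.2) • Measure.dirac (x q)) Set.univ =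
      ENNReal.ofReal (∑ q : {p : Fin n × Fin n // p.1 ≠ p.2}, e q.1.1 * e q.1.2) := by
    rw [ENNReal.ofReal_sum_of_nonneg fun q _ => (mul_pos (he _) (he _)).le]
    simp
  rw [hmass, Finset.smul_sum]
  refine Finset.sum_congr rfl fun q _ => ?_
  rw [smul_smul]
  congr 1
  have : ∀ q : {p : Fin n × Fin n // p.1 ≠ p.2}, e q.1.1 / (∑ j, e j) * (e q.1.2 / ∑ j, e j) =
      e q.1.1 * e q.1.2 / (∑ j, e j) ^ 2 := fun q => by field_simp
  simp_rw [this]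
  rw [← Finset.sum_div, div_div_div_cancel_right₀ (by positivity), ENNReal.ofReal_div_of_pos hpos,
    ENNReal.div_eq_inv_mul]

/-- The part of `pairMeasure f (s P + ∑ i, e i δ_{c i})` that involves `P`. -/
noncomputable def restMeasure (f : C → C → X) {n : ℕ} (c : Fin n → C) (e : Fin n → ℝ)
    (P : ProbabilityMeasure C) (s : ℝ) : Measure X :=
  (((ENNReal.ofReal s • (P : Measure C)).prod (ENNReal.ofReal s • (P : Measure C)) +
    (ENNReal.ofReal s • (P : Measure C)).prod (atoms c e) +
    (atoms c e).prod (ENNReal.ofReal s • (P : Measure C))).restrict {p | p.1 ≠ p.2}).map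
      fun p => f p.1 p.2

lemma pairMeasure_rawDraw {f : C → C → X} (hf : Measurable fun p : C × C => f p.1 p.2) {n : ℕ}
    (c : Fin n → C) (e : Fin n → ℝ) (P : ProbabilityMeasure C) (s : ℝ) :
    pairMeasure f (rawDraw c (P, s, e)) = pairMeasure f (atoms c e) + restMeasure f c e P s := by
  have : IsFiniteMeasure (ENNReal.ofReal s • (P : Measure C)) :=
    Measure.smul_finite _ ENNReal.ofReal_ne_top
  rw [pairMeasure, pairMeasure, restMeasure, ← Measure.map_add _ _ hf, ← Measure.restrict_add]
  congr 2
  change (ENNReal.ofReal s • (P : Measure C) + atoms c e).prod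
    (ENNReal.ofReal s • (P : Measure C) + atoms c e) = _
  rw [Measure.prod_add, Measure.add_prod, Measure.add_prod]
  abel

/-- The integral of the weight with respect to `restMeasure`, where `g` is the weight of a pair. -/
noncomputable def restMass (g : C × C → ℝ≥0∞) {n : ℕ} (c : Fin n → C) (e : Fin n → ℝ)
    (z : ProbabilityMeasure C × ℝ) : ℝ≥0∞ :=
  ENNReal.ofReal z.2 ^ 2 * ∫⁻ p, g p ∂((z.1 : Measure C).prod (z.1 : Measure C)) +
    ENNReal.ofReal z.2 * ∫⁻ y, (∑ i, ENNReal.ofReal (e i) * (g (y, c i) + g (c i, y)))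
      ∂(z.1 : Measure C)

lemma lintegral_restMeasure [StandardBorelSpace C] {f : C → C → X}
    (hf : Measurable fun p : C × C => f p.1 p.2) {n : ℕ}
    (c : Fin n → C) (e : Fin n → ℝ) (P : ProbabilityMeasure C) (s : ℝ)
    {w : X → ℝ≥0∞} (hw : Measurable w) :
    ∫⁻ y, w y ∂(restMeasure f c e P s) =
      restMass ({p | p.1 ≠ p.2}.indicator fun p => w (f p.1 p.2)) c e (P, s) := by
  have : IsFiniteMeasure (ENNReal.ofReal s • (P : Measure C)) :=
    Measure.smul_finite _ ENNReal.ofReal_ne_top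
  set g : C × C → ℝ≥0∞ := {p | p.1 ≠ p.2}.indicator fun p => w (f p.1 p.2)
  have hg : Measurable g := (hw.comp hf).indicator measurableSet_offDiag
  rw [restMeasure, lintegral_map hw hf, ← lintegral_indicator measurableSet_offDiag]
  change ∫⁻ p, g p ∂_ = _
  rw [lintegral_add_measure, lintegral_add_measure, restMass, add_assoc]
  congr 1
  · rw [Measure.prod_smul_left, Measure.prod_smul_right, lintegral_smul_measure,
      lintegral_smul_measure, smul_eq_mul, smul_eq_mul]
    ring
  · rw [lintegral_prod_symm _ hg.aemeasurable, lintegral_prod _ hg.aemeasurable,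
      lintegral_atoms _ _ (by fun_prop), lintegral_atoms _ _ (by fun_prop),
      ← Finset.sum_add_distrib, lintegral_finsetSum _ (fun i _ => by fun_prop), Finset.mul_sum]
    refine Finset.sum_congr rfl fun i _ => ?_
    rw [lintegral_smul_measure, lintegral_smul_measure, lintegral_const_mul _ (by fun_prop),
      lintegral_add_left (by fun_prop), smul_eq_mul, smul_eq_mul]
    ring

lemma measurable_restMass {g : C × C → ℝ≥0∞} (hg : Measurable g) {n : ℕ} (c : Fin n → C)
    (e : Fin n → ℝ) : Measurable (restMass g c e) := by
  have h1 : Measurable fun z : ProbabilityMeasure C × ℝ =>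
      ∫⁻ p, g p ∂((z.1 : Measure C).prod (z.1 : Measure C)) :=
    (Measure.measurable_lintegral hg).comp
      ((ProbabilityMeasure.measurable_fun_prod (α := C) (β := C)).comp
        (f := fun z : ProbabilityMeasure C × ℝ => (z.1, z.1)) (by fun_prop))
  have h2 : Measurable fun z : ProbabilityMeasure C × ℝ =>
      ∫⁻ y, (∑ i, ENNReal.ofReal (e i) * (g (y, c i) + g (c i, y))) ∂(z.1 : Measure C) :=
    (Measure.measurable_lintegral (by fun_prop)).comp (measurable_subtype_coe.comp measurable_fst)
  unfold restMass
  fun_prop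

/-- The expected mass of the remainder is of order `α` as `α ↓ 0`. -/
lemma IsDirichletProcess.lintegral_restMass [StandardBorelSpace C] [Nonempty C] {Q : Measure C}
    [IsProbabilityMeasure Q] {α : ℝ} {D : Measure (ProbabilityMeasure C)}
    (h : IsDirichletProcess Q α D) (hα : 0 < α) {g : C × C → ℝ≥0∞} (hg : Measurable g)
    {n : ℕ} (c : Fin n → C) (e : Fin n → ℝ) :
    ∫⁻ z, restMass ({p | p.1 ≠ p.2}.indicator g) c e z ∂(D.prod (gammaLaw α)) =
      ENNReal.ofReal α ^ 2 * ∫⁻ p in {p | p.1 ≠ p.2}, g p ∂(Q.prod Q) +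
      ENNReal.ofReal α * ∫⁻ y, (∑ i, ENNReal.ofReal (e i) *
        ({p | p.1 ≠ p.2}.indicator g (y, c i) + {p | p.1 ≠ p.2}.indicator g (c i, y))) ∂Q := by
  have := h.isProbabilityMeasure
  have := isProbabilityMeasure_gammaLaw hα.le
  have hG : Measurable ({p : C × C | p.1 ≠ p.2}.indicator g) := hg.indicator measurableSet_offDiag
  set G := {p : C × C | p.1 ≠ p.2}.indicator g with hGdef
  have hs : Measurable fun y : C => ∑ i, ENNReal.ofReal (e i) * (G (y, c i) + G (c i, y)) := by
    fun_prop
  have h1 : Measurable fun P : ProbabilityMeasure C =>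
      ∫⁻ p, G p ∂((P : Measure C).prod (P : Measure C)) :=
    (Measure.measurable_lintegral hG).comp
      ((ProbabilityMeasure.measurable_fun_prod (α := C) (β := C)).comp
        (f := fun P : ProbabilityMeasure C => (P, P)) (by fun_prop))
  have h2 : Measurable fun P : ProbabilityMeasure C =>
      ∫⁻ y, (∑ i, ENNReal.ofReal (e i) * (G (y, c i) + G (c i, y))) ∂(P : Measure C) :=
    (Measure.measurable_lintegral hs).comp measurable_subtype_coe
  have h3 : Measurable fun z : ProbabilityMeasure C × ℝ => ENNReal.ofReal z.2 ^ 2 *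
      ∫⁻ p, G p ∂((z.1 : Measure C).prod (z.1 : Measure C)) :=
    Measurable.mul (by fun_prop) (h1.comp measurable_fst)
  unfold restMass
  rw [lintegral_add_left h3]
  have e1 := lintegral_prod_mul (μ := D) (ν := gammaLaw α) h1.aemeasurable
    (g := fun s => ENNReal.ofReal s ^ 2) (by fun_prop)
  have e2 := lintegral_prod_mul (μ := D) (ν := gammaLaw α) h2.aemeasurable
    (g := fun s => ENNReal.ofReal s) (by fun_prop)
  simp_rw [mul_comm (ENNReal.ofReal _ ^ 2), mul_comm (ENNReal.ofReal (Prod.snd _))]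
  rw [e1, e2, h.lintegral_mean hα hs, lintegral_ofReal_gammaLaw hα.le, mul_comm _ (∫⁻ s, _ ∂_),
    mul_comm _ (ENNReal.ofReal α), hGdef]
  simp_rw [lintegral_indicator measurableSet_offDiag]
  rw [h.lintegral_offDiag hα hg]
  ring

end Dyad

/-! ### Convergence of the posterior given the unobserved points -/

section Convergence

variable {C X : Type*} [MeasurableSpace C] [StandardBorelSpace C] [Nonempty C]
  [MeasurableSpace X] [Nonempty X]

/-- The weight of a pair of points: `1 + F` at their dyad, off the diagonal. -/
noncomputable def pairWeight (F : X → ℝ≥0) (f : C → C → X) : C × C → ℝ≥0∞ :=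
  {p | p.1 ≠ p.2}.indicator fun p => 1 + F (f p.1 p.2)

/-- The law of a dyad under a posterior draw is close to the bootstrap draw with the same
exponential weights if the part of the draw that involves `P` has small mass. -/
lemma dyadLaw_postDraw_close {f : C → C → X} (hf : Measurable fun p : C × C => f p.1 p.2)
    {F : X → ℝ≥0} (hF : Measurable F) {n : ℕ} (hn : 2 ≤ n) {c : Fin n → C}
    (hc : Function.Injective c) {e : Fin n → ℝ} (he : ∀ i, 0 < e i) {δ : ℝ} (hδ : 0 < δ) :
    ∃ K : ℝ≥0∞, K ≠ 0 ∧ ∀ (P : ProbabilityMeasure C) (s : ℝ), 0 < s →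
      restMass (pairWeight F f) c e (P, s) ≤ K → ∀ A : Set X,
        let μ := weightedEmpirical (fun q => f (c q.1.1) (c q.1.2) : DyadicData n X)
          (fun i => e i / ∑ j, e j)
        let ν := dyadLaw f (postDraw c (P, s, e))
        ∫⁻ y in A, (1 + F y) ∂(ν : Measure X) ≤
          ∫⁻ y in A, (1 + F y) ∂(μ : Measure X) + ENNReal.ofReal δ ∧
        ∫⁻ y in A, (1 + F y) ∂(μ : Measure X) ≤
          ∫⁻ y in A, (1 + F y) ∂(ν : Measure X) + ENNReal.ofReal δ := by
  have hw : Measurable fun y => 1 + (F y : ℝ≥0∞) := by fun_prop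
  set N := pairMeasure f (atoms c e) with hNdef
  have hμ : weightedEmpirical (fun q => f (c q.1.1) (c q.1.2) : DyadicData n X)
      (fun i => e i / ∑ j, e j) = normalize N := by
    rw [hNdef, pairMeasure_atoms hf hc fun i => (he i).le, weightedEmpirical_normalize hn _ he]
  have hNuniv : N Set.univ = ENNReal.ofReal
      (∑ q : {p : Fin n × Fin n // p.1 ≠ p.2}, e q.1.1 * e q.1.2) := by
    rw [hNdef, pairMeasure_atoms hf hc fun i => (he i).le,
      ENNReal.ofReal_sum_of_nonneg fun q _ => (mul_pos (he _) (he _)).le]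
    simp
  have hN0 : N Set.univ ≠ 0 := by rw [hNuniv]; simpa using offDiag_sum_pos hn he
  have hNt : N Set.univ ≠ ∞ := by rw [hNuniv]; exact ENNReal.ofReal_ne_top
  set B := ∫⁻ y, (1 + F y) ∂(normalize N : Measure X) with hB
  have hBt : B ≠ ∞ := by
    rw [hB, coe_normalize hN0 hNt, lintegral_smul_measure, hNdef,
      pairMeasure_atoms hf hc fun i => (he i).le, lintegral_finsetSum_measure]
    refine ENNReal.mul_ne_top (ENNReal.inv_ne_top.2 (by
      rw [← pairMeasure_atoms hf hc fun i => (he i).le]; exact hN0)) ?_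
    refine ENNReal.sum_ne_top.2 fun q _ => ?_
    rw [lintegral_smul_measure, lintegral_dirac' _ hw]
    exact ENNReal.mul_ne_top ENNReal.ofReal_ne_top (by simp)
  refine ⟨N Set.univ * ENNReal.ofReal δ / (1 + B), ?_, fun P s hs hrest A => ?_⟩
  · exact ENNReal.div_ne_zero.2 ⟨mul_ne_zero hN0 (by simpa using hδ), by simp [hBt]⟩
  have hS : 0 < s + ∑ i, e i := add_pos_of_pos_of_nonneg hs (Finset.sum_nonneg fun i _ => (he i).le)
  have hν : dyadLaw f (postDraw c (P, s, e)) = normalize (N + restMeasure f c e P s) := by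
    have : IsFiniteMeasure (rawDraw c (P, s, e)) :=
      ⟨by rw [rawDraw_univ c hs.le fun i => (he i).le]; exact ENNReal.ofReal_lt_top⟩
    have hk0 : (ENNReal.ofReal (s + ∑ i, e i))⁻¹ ≠ 0 := ENNReal.inv_ne_zero.2 ENNReal.ofReal_ne_top
    have hkt : (ENNReal.ofReal (s + ∑ i, e i))⁻¹ ≠ ∞ := ENNReal.inv_ne_top.2 (by simpa using hS)
    rw [dyadLaw_eq hf, coe_postDraw c hs fun i => (he i).le, pairMeasure_smul,
      normalize_smul _ (mul_ne_zero hk0 hk0) (ENNReal.mul_ne_top hkt hkt),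
      pairMeasure_rawDraw hf]
  have hL : ∫⁻ y, (1 + F y) ∂(restMeasure f c e P s) ≤
      N Set.univ * ENNReal.ofReal δ / (1 + B) := by
    rw [lintegral_restMeasure hf c e P s hw]; exact hrest
  have hLu : restMeasure f c e P s Set.univ ≤ N Set.univ * ENNReal.ofReal δ / (1 + B) := by
    refine le_trans ?_ hL
    rw [← lintegral_one]
    exact lintegral_mono fun y => le_self_add
  have hle : N Set.univ * ENNReal.ofReal δ / (1 + B) ≤ N Set.univ * ENNReal.ofReal δ :=
    ENNReal.div_le_of_le_mul (le_mul_of_one_le_right' le_self_add)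
  simp only [hμ, hν]
  refine normalize_add_close hN0 hNt ?_ (hL.trans hle) ?_ A
  · exact ((hLu.trans hle).trans_lt (ENNReal.mul_lt_top hNt.lt_top ENNReal.ofReal_lt_top)).ne
  · calc restMeasure f c e P s Set.univ * B
        ≤ N Set.univ * ENNReal.ofReal δ / (1 + B) * (1 + B) := by
          gcongr
          exact le_add_self
      _ ≤ N Set.univ * ENNReal.ofReal δ := (mul_comm _ _).trans_le ENNReal.mul_div_le

variable {Q : Measure C} [IsProbabilityMeasure Q] {DP : ℝ → Measure (ProbabilityMeasure C)}

lemma measurable_theta_postDraw {H : Type*} [MeasurableSpace H]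
    {T : ProbabilityMeasure X → ℝ} (hT : Measurable T) {h : H → C → C → X}
    (hh : Measurable fun p : H × C × C => h p.1 p.2.1 p.2.2) {n : ℕ} :
    Measurable fun p : (H × (Fin n → C)) × (ProbabilityMeasure C × ℝ × (Fin n → ℝ)) =>
      T (dyadLaw (h p.1.1) (postDraw p.1.2 p.2)) :=
  hT.comp ((measurable_dyadLaw hh).comp (measurable_fst.fst.prodMk
    (measurable_postDraw.comp (measurable_fst.snd.prodMk measurable_snd))))

/-- For fixed exponential weights `e`, the remaining randomness of the posterior draw disappears as
`α ↓ 0`: the mass of the Dirichlet process component tends to `0` in mean. -/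
lemma tendsto_integral_of_continuousAtTV (hDP : ∀ α : ℝ, 0 < α → IsDirichletProcess Q α (DP α))
    {f : C → C → X} (hf : Measurable fun p : C × C => f p.1 p.2)
    {T : ProbabilityMeasure X → ℝ} (hT : Measurable T) {F : X → ℝ≥0} (hF : Measurable F)
    {n : ℕ} (hn : 2 ≤ n) {c : Fin n → C} (hc : Function.Injective c)
    (hoff : ∫⁻ p in {p | p.1 ≠ p.2}, (1 + F (f p.1 p.2)) ∂(Q.prod Q) ≠ ∞)
    (hcross : ∀ i, ∫⁻ y, (pairWeight F f (y, c i) + pairWeight F f (c i, y)) ∂Q ≠ ∞)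
    {e : Fin n → ℝ} (he : ∀ i, 0 < e i)
    (hcont : ContinuousAtTV F T
      (weightedEmpirical (fun q => f (c q.1.1) (c q.1.2) : DyadicData n X)
        (fun i => e i / ∑ j, e j)))
    (φ : BoundedContinuousFunction ℝ ℝ) :
    Tendsto (fun α => ∫ z, φ (T (dyadLaw f (postDraw c (z.1, z.2, e))))
        ∂((DP α).prod (gammaLaw α))) (𝓝[>] 0)
      (𝓝 (φ (T (weightedEmpirical (fun q => f (c q.1.1) (c q.1.2) : DyadicData n X)
        (fun i => e i / ∑ j, e j))))) := by
  set μ := weightedEmpirical (fun q => f (c q.1.1) (c q.1.2) : DyadicData n X)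
    (fun i => e i / ∑ j, e j)
  have hmeas : Measurable fun z : ProbabilityMeasure C × ℝ =>
      φ (T (dyadLaw f (postDraw c (z.1, z.2, e)))) := by
    refine φ.continuous.measurable.comp ?_
    have := measurable_theta_postDraw (H := Unit) hT (h := fun _ => f)
      (hf.comp measurable_snd) (n := n)
    exact this.comp (f := fun z : ProbabilityMeasure C × ℝ => (((), c), (z.1, z.2, e)))
      (by fun_prop)
  have hg : Measurable fun p : C × C => 1 + (F (f p.1 p.2) : ℝ≥0∞) := by fun_prop
  rw [Metric.tendsto_nhds]
  intro ε hε
  obtain ⟨ε', hε', hφ⟩ := Metric.continuousAt_iff.1 (φ.continuous.continuousAt (x := T μ)) (ε / 2)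
    (by positivity)
  obtain ⟨δ, hδ, hTδ⟩ := hcont ε' hε'
  obtain ⟨K, hK0, hK⟩ := dyadLaw_postDraw_close hf hF hn hc he hδ
  -- the expected weighted mass of the Dirichlet process component
  let A₀ := ∫⁻ p in {p | p.1 ≠ p.2}, (1 + (F (f p.1 p.2) : ℝ≥0∞)) ∂(Q.prod Q)
  let B₀ := ∫⁻ y, (∑ i, ENNReal.ofReal (e i) *
    (pairWeight F f (y, c i) + pairWeight F f (c i, y))) ∂Q
  have hpw : Measurable (pairWeight F f) := hg.indicator measurableSet_offDiag
  have hB₀ : B₀ ≠ ∞ := by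
    simp only [B₀]
    rw [lintegral_finsetSum _ fun i _ => by fun_prop]
    refine ENNReal.sum_ne_top.2 fun i _ => ?_
    rw [lintegral_const_mul _ (by fun_prop)]
    exact ENNReal.mul_ne_top ENNReal.ofReal_ne_top (hcross i)
  let Ψ : ℝ → ℝ≥0∞ := fun α => (ENNReal.ofReal α ^ 2 * A₀ + ENNReal.ofReal α * B₀) / K
  have hΨ : Tendsto Ψ (𝓝[>] 0) (𝓝 0) := by
    have h0 : Tendsto (fun α : ℝ => ENNReal.ofReal α) (𝓝[>] 0) (𝓝 0) := by
      have := (ENNReal.continuous_ofReal.tendsto 0).mono_left (nhdsWithin_le_nhds (s := Set.Ioi 0))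
      simpa using this
    have h1 : Tendsto (fun α : ℝ => ENNReal.ofReal α ^ 2 * A₀) (𝓝[>] 0) (𝓝 0) := by
      have := ENNReal.Tendsto.mul_const (b := A₀) (ENNReal.Tendsto.pow (n := 2) h0) (Or.inr hoff)
      simpa using this
    have h2 : Tendsto (fun α : ℝ => ENNReal.ofReal α * B₀) (𝓝[>] 0) (𝓝 0) := by
      have := ENNReal.Tendsto.mul_const (b := B₀) h0 (Or.inr hB₀)
      simpa using this
    have := ENNReal.Tendsto.div_const (b := K) (h1.add h2) (Or.inr hK0)
    simpa [Ψ] using this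
  have hΨ' : Tendsto (fun α => ε / 2 + 2 * ‖φ‖ * (Ψ α).toReal) (𝓝[>] 0) (𝓝 (ε / 2)) := by
    have := (ENNReal.tendsto_toReal ENNReal.zero_ne_top).comp hΨ
    have := (this.const_mul (2 * ‖φ‖)).const_add (ε / 2)
    simpa using this
  have hΨt : ∀ᶠ α in 𝓝[>] (0 : ℝ), Ψ α < 1 := hΨ.eventually_lt_const (by simp)
  filter_upwards [hΨ'.eventually_lt_const (half_lt_self hε), hΨt, self_mem_nhdsWithin]
    with α hα1 hα2 hα
  have hα : 0 < α := hα
  have := (hDP α hα).isProbabilityMeasure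
  have := isProbabilityMeasure_gammaLaw hα.le
  set ρ := (DP α).prod (gammaLaw α)
  have hint : Integrable (fun z : ProbabilityMeasure C × ℝ =>
      φ (T (dyadLaw f (postDraw c (z.1, z.2, e))))) ρ :=
    Integrable.of_bound hmeas.aestronglyMeasurable ‖φ‖ (ae_of_all _ fun z => φ.norm_coe_le_norm _)
  let bad : Set (ProbabilityMeasure C × ℝ) := {z | K ≤ restMass (pairWeight F f) c e z}
  have hbadm : MeasurableSet bad := measurableSet_le measurable_const (measurable_restMass hpw c e)
  have hbad : ρ bad ≤ Ψ α := by
    rcases eq_or_ne K ∞ with hKt | hKt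
    · -- the weighted mass is integrable, hence almost surely finite
      have hfin : ∀ᵐ z ∂ρ, restMass (pairWeight F f) c e z < ∞ := by
        refine ae_lt_top (measurable_restMass hpw c e) ?_
        rw [pairWeight, (hDP α hα).lintegral_restMass hα hg c e]
        exact ENNReal.add_ne_top.2 ⟨ENNReal.mul_ne_top (ENNReal.pow_ne_top ENNReal.ofReal_ne_top)
          hoff, ENNReal.mul_ne_top ENNReal.ofReal_ne_top hB₀⟩
      have : ρ bad = 0 := by
        rw [measure_eq_zero_iff_ae_notMem]
        filter_upwards [hfin] with z hz
        simp only [bad, hKt, Set.mem_ofPred_eq, not_le, hz]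
      rw [this]; exact zero_le
    · refine (meas_ge_le_lintegral_div (measurable_restMass hpw c e).aemeasurable hK0 hKt).trans ?_
      rw [pairWeight, (hDP α hα).lintegral_restMass hα hg c e]
      exact le_rfl
  have hpos : ∀ᵐ z ∂ρ, 0 < z.2 := Measure.quasiMeasurePreserving_snd.ae (gammaLaw_pos hα)
  have hbound : ∀ᵐ z ∂ρ, ‖φ (T (dyadLaw f (postDraw c (z.1, z.2, e)))) - φ (T μ)‖ ≤
      ε / 2 + bad.indicator (fun _ => 2 * ‖φ‖) z := by
    filter_upwards [hpos] with z hz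
    by_cases hzb : z ∈ bad
    · rw [Set.indicator_of_mem hzb, ← dist_eq_norm]
      have := φ.dist_le_two_norm (T (dyadLaw f (postDraw c (z.1, z.2, e)))) (T μ)
      linarith
    · rw [Set.indicator_of_notMem hzb, add_zero, ← dist_eq_norm]
      have hz' : restMass (pairWeight F f) c e (z.1, z.2) ≤ K := (not_le.1 hzb).le
      exact (hφ (by
        rw [Real.dist_eq]
        exact hTδ _ fun A _ => hK z.1 z.2 hz hz' A)).le
  have hrep : ∫ z, φ (T (dyadLaw f (postDraw c (z.1, z.2, e)))) ∂ρ - φ (T μ) =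
      ∫ z, (φ (T (dyadLaw f (postDraw c (z.1, z.2, e)))) - φ (T μ)) ∂ρ := by
    rw [integral_sub hint (integrable_const _)]
    simp
  rw [dist_eq_norm, hrep]
  calc _ ≤ ∫ z, ‖φ (T (dyadLaw f (postDraw c (z.1, z.2, e)))) - φ (T μ)‖ ∂ρ :=
        norm_integral_le_integral_norm _
    _ ≤ ∫ z, (ε / 2 + bad.indicator (fun _ => 2 * ‖φ‖) z) ∂ρ :=
        integral_mono_ae (hint.sub (integrable_const _)).norm
          ((integrable_const _).add ((integrable_const _).indicator hbadm)) hbound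
    _ = ε / 2 + ρ.real bad * (2 * ‖φ‖) := by
        rw [integral_add (integrable_const _) ((integrable_const _).indicator hbadm),
          integral_indicator_const _ hbadm]
        simp
    _ ≤ ε / 2 + 2 * ‖φ‖ * (Ψ α).toReal := by
        rw [mul_comm]
        gcongr
        exact ENNReal.toReal_mono (hα2.trans ENNReal.one_lt_top).ne hbad
    _ < ε := hα1

lemma measurable_weightedEmpirical {n : ℕ} (x : DyadicData n X) :
    Measurable (weightedEmpirical x) :=
  measurable_asProb.comp (measurable_measure_sum fun q =>
    measurable_measure_smul (by fun_prop) measurable_const)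

/-- Given the link function and the unobserved points, the law of `θ` converges to the law of a
Bayesian bootstrap draw as `α ↓ 0`. -/
lemma tendsto_integral_drawLaw (hDP : ∀ α : ℝ, 0 < α → IsDirichletProcess Q α (DP α))
    {f : C → C → X} (hf : Measurable fun p : C × C => f p.1 p.2)
    {T : ProbabilityMeasure X → ℝ} (hT : Measurable T) {F : X → ℝ≥0} (hF : Measurable F)
    {n : ℕ} (hn : 2 ≤ n) {c : Fin n → C} (hc : Function.Injective c)
    (hoff : ∫⁻ p in {p | p.1 ≠ p.2}, (1 + F (f p.1 p.2)) ∂(Q.prod Q) ≠ ∞)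
    (hcross : ∀ i, ∫⁻ y, (pairWeight F f (y, c i) + pairWeight F f (c i, y)) ∂Q ≠ ∞)
    (hcont : ContinuousAtDraws F T (fun q => f (c q.1.1) (c q.1.2) : DyadicData n X))
    (φ : BoundedContinuousFunction ℝ ℝ) :
    Tendsto (fun α => ∫ ω, φ (T (dyadLaw f (postDraw c ω))) ∂(drawLaw (DP α) α n)) (𝓝[>] 0)
      (𝓝 (∫ y, φ y ∂(bootstrapLaw T
        (fun q => f (c q.1.1) (c q.1.2) : DyadicData n X) : Measure ℝ))) := by
  set x : DyadicData n X := fun q => f (c q.1.1) (c q.1.2)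
  have hmeas : Measurable fun ω : ProbabilityMeasure C × ℝ × (Fin n → ℝ) =>
      φ (T (dyadLaw f (postDraw c ω))) := by
    refine φ.continuous.measurable.comp ?_
    have := measurable_theta_postDraw (H := Unit) hT (h := fun _ => f)
      (hf.comp measurable_snd) (n := n)
    exact this.comp (f := fun ω : ProbabilityMeasure C × ℝ × (Fin n → ℝ) => (((), c), ω))
      (by fun_prop)
  have hTw : Measurable fun w => T (weightedEmpirical x w) :=
    hT.comp (measurable_weightedEmpirical x)
  have hdir := isProbabilityMeasure_dirichlet (J := Fin n) (a := fun _ => 1) fun _ => zero_le_one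
  have hboot : ∫ y, φ y ∂(bootstrapLaw T x : Measure ℝ) =
      ∫ e, φ (T (weightedEmpirical x fun i => e i / ∑ j, e j)) ∂(gammaPi fun _ : Fin n => 1) := by
    have : IsProbabilityMeasure ((dirichlet fun _ : Fin n => (1 : ℝ)).map
        fun w => T (weightedEmpirical x w)) := Measure.isProbabilityMeasure_map hTw.aemeasurable
    rw [bootstrapLaw, coe_asProb, integral_map hTw.aemeasurable
      φ.continuous.aestronglyMeasurable, dirichlet_eq,
      integral_map measurable_normalize.aemeasurable
        (Measurable.aestronglyMeasurable (by exact φ.continuous.measurable.comp hTw))]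
  have hpos : ∀ᵐ e ∂(gammaPi fun _ : Fin n => 1), ∀ i, 0 < e i := by
    rw [ae_all_iff]
    intro j
    exact (Measure.quasiMeasurePreserving_eval _ j).ae (gammaLaw_pos one_pos)
  have hcont' : ∀ᵐ e ∂(gammaPi fun _ : Fin n => 1),
      ContinuousAtTV F T (weightedEmpirical x fun i => e i / ∑ j, e j) := by
    have := hcont
    rw [ContinuousAtDraws, dirichlet_eq] at this
    exact ae_of_ae_map measurable_normalize.aemeasurable this
  rw [hboot]
  -- Fubini: integrate over the Dirichlet process component first
  have hfub : (fun α => ∫ ω, φ (T (dyadLaw f (postDraw c ω))) ∂(drawLaw (DP α) α n)) =ᶠ[𝓝[>] 0]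
      fun α => ∫ e, ∫ z, φ (T (dyadLaw f (postDraw c (z.1, z.2, e))))
        ∂((DP α).prod (gammaLaw α)) ∂(gammaPi fun _ : Fin n => 1) := by
    filter_upwards [self_mem_nhdsWithin] with α hα
    have := (hDP α hα).isProbabilityMeasure
    have := isProbabilityMeasure_gammaLaw (le_of_lt hα)
    have hm2 : Measurable fun p : (ProbabilityMeasure C × ℝ) × (Fin n → ℝ) =>
        φ (T (dyadLaw f (postDraw c (p.1.1, p.1.2, p.2)))) :=
      hmeas.comp (f := fun p : (ProbabilityMeasure C × ℝ) × (Fin n → ℝ) =>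
        (p.1.1, p.1.2, p.2)) (by fun_prop)
    rw [drawLaw, ← Measure.prodAssoc_prod, integral_map (MeasurableEquiv.measurable _).aemeasurable
      hmeas.aestronglyMeasurable]
    exact integral_prod_symm (fun p : (ProbabilityMeasure C × ℝ) × (Fin n → ℝ) =>
      φ (T (dyadLaw f (postDraw c (p.1.1, p.1.2, p.2)))))
      (Integrable.of_bound hm2.aestronglyMeasurable ‖φ‖
        (ae_of_all _ fun z => φ.norm_coe_le_norm _))
  refine Tendsto.congr' hfub.symm ?_
  refine tendsto_integral_filter_of_dominated_convergence (fun _ => ‖φ‖) ?_ ?_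
    (integrable_const _) ?_
  · filter_upwards [self_mem_nhdsWithin] with α hα
    have := (hDP α hα).isProbabilityMeasure
    have := isProbabilityMeasure_gammaLaw (le_of_lt hα)
    have hm2 : Measurable fun p : (Fin n → ℝ) × (ProbabilityMeasure C × ℝ) =>
        φ (T (dyadLaw f (postDraw c (p.2.1, p.2.2, p.1)))) :=
      hmeas.comp (f := fun p : (Fin n → ℝ) × (ProbabilityMeasure C × ℝ) =>
        (p.2.1, p.2.2, p.1)) (by fun_prop)
    exact (hm2.stronglyMeasurable.integral_prod_right'
      (ν := (DP α).prod (gammaLaw α))).aestronglyMeasurable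
  · filter_upwards [self_mem_nhdsWithin] with α hα
    have := (hDP α hα).isProbabilityMeasure
    have := isProbabilityMeasure_gammaLaw (le_of_lt hα)
    refine ae_of_all _ fun e => ?_
    refine (norm_integral_le_of_norm_le_const (C := ‖φ‖)
      (ae_of_all _ fun z => φ.norm_coe_le_norm _)).trans ?_
    simp
  · filter_upwards [hpos, hcont'] with e he hce
    exact tendsto_integral_of_continuousAtTV hDP hf hT hF hn hc hoff hcross he hce φ

end Convergence

/-! ### Reduction to a standard Borel index space -/

/-- A measurable set in a product belongs to a `σ`-algebra generated by countably many rectangles;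
the map `φ` records the first factors of these. -/
lemma exists_factor_set {H Y : Type*} [MeasurableSpace H] [MeasurableSpace Y] {S : Set (H × Y)}
    (hS : MeasurableSet S) :
    ∃ (φ : H → ℕ → Bool) (S' : Set ((ℕ → Bool) × Y)), Measurable φ ∧ MeasurableSet S' ∧
      ∀ t y, (t, y) ∈ S ↔ (φ t, y) ∈ S' := by
  classical
  rw [← generateFrom_prod] at hS
  induction S, hS using MeasurableSpace.generateFrom_induction with
  | hC S hS _ =>
    obtain ⟨A, hA, B, hB, rfl⟩ := hS
    refine ⟨fun t _ => decide (t ∈ A), {b | b 0 = true} ×ˢ B,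
      measurable_pi_lambda _ fun _ => measurable_to_bool ?_, ?_, fun t y => ?_⟩
    · have : (fun t => decide (t ∈ A)) ⁻¹' {true} = A := by ext t; simp
      rw [this]
      exact hA
    · exact ((measurable_pi_apply 0 : Measurable fun b : ℕ → Bool => b 0)
        (measurableSet_singleton true)).prod hB
    · simp
  | empty => exact ⟨fun _ _ => true, ∅, measurable_const, MeasurableSet.empty, by simp⟩
  | compl S _ ih =>
    obtain ⟨φ, S', hφ, hS', h⟩ := ih
    exact ⟨φ, S'ᶜ, hφ, hS'.compl, fun t y => by simp [h]⟩
  | iUnion S _ ih =>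
    choose φ S' hφ hS' h using ih
    -- code the sequence of maps `φ k` by one map
    refine ⟨fun t m => φ m.unpair.1 t m.unpair.2,
      ⋃ k, (fun p : (ℕ → Bool) × Y => ((fun j => p.1 (Nat.pair k j)), p.2)) ⁻¹' S' k,
      measurable_pi_lambda _ fun m => (measurable_pi_apply _).comp (hφ _),
      MeasurableSet.iUnion fun k => (by fun_prop :
        Measurable fun p : (ℕ → Bool) × Y => ((fun j => p.1 (Nat.pair k j)), p.2)) (hS' k),
      fun t y => ?_⟩
    simp [h]

/-- A jointly measurable family of maps into a standard Borel space depends on its index only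
through countably many measurable events. -/
lemma exists_factor {H Y X : Type*} [MeasurableSpace H] [MeasurableSpace Y] [MeasurableSpace X]
    [StandardBorelSpace X] [Nonempty X] {h : H × Y → X} (hh : Measurable h) :
    ∃ (φ : H → ℕ → Bool) (g : (ℕ → Bool) × Y → X), Measurable φ ∧ Measurable g ∧
      ∀ t y, h (t, y) = g (φ t, y) := by
  classical
  let ι := MeasurableSpace.mapNatBool X
  have hι : MeasurableEmbedding ι :=
    (MeasurableSpace.measurable_mapNatBool X).measurableEmbedding
      (MeasurableSpace.injective_mapNatBool X)
  have hS : ∀ k, MeasurableSet {p : H × Y | ι (h p) k = true} := fun k =>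
    ((measurable_pi_apply k).comp (hι.measurable.comp hh)) (measurableSet_singleton true)
  choose φ S' hφ hS' hmem using fun k => exists_factor_set (hS k)
  obtain ⟨ρ, hρ, hρι⟩ := hι.exists_measurable_extend measurable_id fun _ => inferInstance
  let G : (ℕ → Bool) × Y → ℕ → Bool := fun p k =>
    decide (((fun j => p.1 (Nat.pair k j)), p.2) ∈ S' k)
  have hG : Measurable G := by
    refine measurable_pi_lambda _ fun k => measurable_to_bool ?_
    have : Measurable fun p : (ℕ → Bool) × Y => ((fun j => p.1 (Nat.pair k j)), p.2) := by
      fun_prop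
    convert this (hS' k)
    ext p; simp [G]
  refine ⟨fun t m => φ m.unpair.1 t m.unpair.2, ρ ∘ G,
    measurable_pi_lambda _ fun m => (measurable_pi_apply _).comp (hφ _), hρ.comp hG, fun t y => ?_⟩
  have : G ((fun m => φ m.unpair.1 t m.unpair.2), y) = ι (h (t, y)) := by
    ext k
    have := hmem k t y
    simp only [Set.mem_ofPred_eq] at this
    simp only [G, Nat.unpair_pair, ← this, Bool.decide_eq_true]
  rw [Function.comp, this]
  exact (congrFun hρι (h (t, y))).symm

/-! ### The posterior of the structural parameter -/

section Posterior

variable {H C X : Type*} [MeasurableSpace H] [MeasurableSpace C] [StandardBorelSpace C]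
  [MeasurableSpace X]

lemma measurable_theta [Nonempty X] {T : ProbabilityMeasure X → ℝ} (hT : Measurable T)
    {h : H → C → C → X} (hh : Measurable fun p : H × C × C => h p.1 p.2.1 p.2.2) {n : ℕ} :
    Measurable (theta T h (n := n)) :=
  hT.comp ((measurable_dyadLaw hh).comp measurable_fst)

/-- The conditional law of `θ` given the index of the link function and the unobserved points. -/
noncomputable def thetaKernel [Nonempty C] [Nonempty X] (T : ProbabilityMeasure X → ℝ)
    (h : H → C → C → X) {n : ℕ}
    (ν : Measure (ProbabilityMeasure C × ℝ × (Fin n → ℝ))) : Kernel (H × (Fin n → C)) ℝ :=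
  (Kernel.id ×ₖ Kernel.const _ ν).map fun p => T (dyadLaw (h p.1.1) (postDraw p.1.2 p.2))

lemma thetaKernel_apply [Nonempty C] [Nonempty X] {T : ProbabilityMeasure X → ℝ}
    (hT : Measurable T) {h : H → C → C → X}
    (hh : Measurable fun p : H × C × C => h p.1 p.2.1 p.2.2) {n : ℕ}
    (ν : Measure (ProbabilityMeasure C × ℝ × (Fin n → ℝ))) [IsProbabilityMeasure ν]
    (p : H × (Fin n → C)) :
    thetaKernel T h ν p = ν.map fun ω => T (dyadLaw (h p.1) (postDraw p.2 ω)) := by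
  rw [thetaKernel, Kernel.map_apply _ (measurable_theta_postDraw hT hh), Kernel.prod_apply,
    Kernel.id_apply, Kernel.const_apply, Measure.dirac_prod,
    Measure.map_map (measurable_theta_postDraw hT hh) measurable_prodMk_left]
  rfl

lemma isMarkovKernel_thetaKernel [Nonempty C] [Nonempty X] {T : ProbabilityMeasure X → ℝ}
    (hT : Measurable T) {h : H → C → C → X}
    (hh : Measurable fun p : H × C × C => h p.1 p.2.1 p.2.2) {n : ℕ}
    (ν : Measure (ProbabilityMeasure C × ℝ × (Fin n → ℝ))) [IsProbabilityMeasure ν] :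
    IsMarkovKernel (thetaKernel T h ν) :=
  Kernel.IsMarkovKernel.map _ (measurable_theta_postDraw hT hh)

variable {Q : Measure C} [IsProbabilityMeasure Q]

/-- Averaging `thetaKernel` over a regular conditional distribution of the unobserved quantities
given the data gives a version of the posterior. -/
lemma IsDirichletProcess.isPosterior [Nonempty C] [Nonempty X] {π : Measure H}
    [IsProbabilityMeasure π] {α : ℝ} {D : Measure (ProbabilityMeasure C)}
    (hD : IsDirichletProcess Q α D) (hα : 0 < α)
    {T : ProbabilityMeasure X → ℝ} (hT : Measurable T) {h : H → C → C → X}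
    (hh : Measurable fun p : H × C × C => h p.1 p.2.1 p.2.2) {n : ℕ}
    {κ : Kernel (DyadicData n X) (H × (Fin n → C))} [IsMarkovKernel κ]
    (hκ : (latentLaw π Q n).map (latentData h) ⊗ₘ κ =
      (latentLaw π Q n).map fun p => (latentData h p, p)) :
    IsPosterior h π D T (thetaKernel T h (drawLaw D α n) ∘ₖ κ) := by
  have := hD.isProbabilityMeasure
  have hν := isProbabilityMeasure_drawLaw D hα n
  have := isMarkovKernel_thetaKernel hT hh (drawLaw D α n)
  have hlat := measurable_latentData (n := n) hh
  have hdata := measurable_data (n := n) hh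
  have htheta := measurable_theta hT hh (n := n)
  refine ⟨(hdata.prodMk htheta).aemeasurable, ?_⟩
  have hdl := hD.dataLaw_eq (π := π) hα n hh
  rw [dataLaw] at hdl
  rw [hdl]
  ext s hs
  have hsec : ∀ x, MeasurableSet (Prod.mk x ⁻¹' s) := fun x => measurable_prodMk_left hs
  have hm1 : Measurable fun q : DyadicData n X × (H × (Fin n → C)) =>
      thetaKernel T h (drawLaw D α n) q.2 (Prod.mk q.1 ⁻¹' s) :=
    Kernel.measurable_kernel_prodMk_left (κ := (thetaKernel T h (drawLaw D α n)).comap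
      (Prod.snd : DyadicData n X × (H × (Fin n → C)) → _) measurable_snd)
      (t := (fun q => (q.1.1, q.2)) ⁻¹' s) ((by fun_prop : Measurable fun q :
        (DyadicData n X × (H × (Fin n → C))) × ℝ => (q.1.1, q.2)) hs)
  have hm2 : Measurable fun p : (H × (Fin n → C)) × (ProbabilityMeasure C × ℝ × (Fin n → ℝ)) =>
      (latentData h p.1, T (dyadLaw (h p.1.1) (postDraw p.1.2 p.2))) :=
    (hlat.comp measurable_fst).prodMk (measurable_theta_postDraw hT hh)
  calc (modelLaw π D n).map (fun ω => (data h ω, theta T h ω)) s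
      = ((latentLaw π Q n).prod (drawLaw D α n)).map (fun p =>
          (latentData h p.1, T (dyadLaw (h p.1.1) (postDraw p.1.2 p.2)))) s := by
        rw [hD.modelLaw_eq π hα n, Measure.map_map (hdata.prodMk htheta) measurable_addDraw]
        rfl
    _ = ∫⁻ p, thetaKernel T h (drawLaw D α n) p (Prod.mk (latentData h p) ⁻¹' s)
          ∂(latentLaw π Q n) := by
        rw [Measure.map_apply hm2 hs, Measure.prod_apply (hm2 hs)]
        refine lintegral_congr fun p => ?_
        rw [thetaKernel_apply hT hh, Measure.map_apply _ (hsec _)]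
        · rfl
        · exact (measurable_theta_postDraw hT hh).comp measurable_prodMk_left
    _ = ∫⁻ q, thetaKernel T h (drawLaw D α n) q.2 (Prod.mk q.1 ⁻¹' s)
          ∂((latentLaw π Q n).map (latentData h) ⊗ₘ κ) := by
        rw [hκ, lintegral_map hm1 (show Measurable fun p => (latentData h p, p) from
          hlat.prodMk measurable_id)]
    _ = ((latentLaw π Q n).map (latentData h) ⊗ₘ
          (thetaKernel T h (drawLaw D α n) ∘ₖ κ)) s := by
        rw [Measure.lintegral_compProd hm1, Measure.compProd_apply hs]
        refine lintegral_congr fun x => ?_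
        rw [Kernel.comp_apply' _ _ _ (hsec x)]

/-- The unobserved quantities at which the law of `θ` converges: no ties, and finite integrals of
the weight against `Q ⊗ Q` and against `Q` in one argument, the other being one of the unobserved
points. -/
def IsGood (Q : Measure C) (F : X → ℝ≥0) (h : H → C → C → X) {n : ℕ} (p : H × (Fin n → C)) :
    Prop :=
  Function.Injective p.2 ∧
    ∫⁻ z in {z : C × C | z.1 ≠ z.2}, (1 + F (h p.1 z.1 z.2)) ∂(Q.prod Q) < ∞ ∧
    ∀ i, ∫⁻ y, (pairWeight F (h p.1) (y, p.2 i) + pairWeight F (h p.1) (p.2 i, y)) ∂Q < ∞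

lemma measurable_pairWeight {F : X → ℝ≥0} (hF : Measurable F) {h : H → C → C → X}
    (hh : Measurable fun p : H × C × C => h p.1 p.2.1 p.2.2) :
    Measurable fun p : H × C × C => pairWeight F (h p.1) p.2 := by
  have h1 : Measurable fun p : H × C × C => (1 + F (h p.1 p.2.1 p.2.2) : ℝ≥0∞) := by fun_prop
  exact h1.indicator (measurable_snd (measurableSet_offDiag (C := C)))

lemma measurableSet_isGood {F : X → ℝ≥0} (hF : Measurable F) {h : H → C → C → X}
    (hh : Measurable fun p : H × C × C => h p.1 p.2.1 p.2.2) {n : ℕ} :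
    MeasurableSet {p : H × (Fin n → C) | IsGood Q F h p} := by
  have hw := measurable_pairWeight hF hh
  have h1 : Measurable fun t : H => ∫⁻ z in {z : C × C | z.1 ≠ z.2}, (1 + F (h t z.1 z.2) : ℝ≥0∞)
      ∂(Q.prod Q) := by
    refine Measurable.lintegral_prod_right ?_
    fun_prop
  have h2 : ∀ i, Measurable fun p : H × (Fin n → C) =>
      ∫⁻ y, (pairWeight F (h p.1) (y, p.2 i) + pairWeight F (h p.1) (p.2 i, y)) ∂Q := by
    intro i
    refine Measurable.lintegral_prod_right ?_
    exact (hw.comp (f := fun q : (H × (Fin n → C)) × C => (q.1.1, q.2, q.1.2 i))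
      (by fun_prop)).add (hw.comp (f := fun q : (H × (Fin n → C)) × C => (q.1.1, q.1.2 i, q.2))
      (by fun_prop))
  simp only [IsGood, Set.ofPred_and, Set.ofPred_forall]
  exact (measurable_snd (measurableSet_injective n)).inter
    ((measurableSet_lt (h1.comp measurable_fst) measurable_const).inter
      (MeasurableSet.iInter fun i => measurableSet_lt (h2 i) measurable_const))

lemma ae_isGood {π : Measure H} [IsProbabilityMeasure π] {F : X → ℝ≥0} (hF : Measurable F)
    {h : H → C → C → X} (hh : Measurable fun p : H × C × C => h p.1 p.2.1 p.2.2) (n : ℕ)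
    (hFQ : ∀ᵐ t ∂π, ∫⁻ p in {p : C × C | p.1 ≠ p.2}, F (h t p.1 p.2) ∂(Q.prod Q) < ∞) :
    ∀ᵐ p ∂(latentLaw π Q n), IsGood Q F h p := by
  rw [latentLaw, Measure.ae_prod_iff_ae_ae (measurableSet_isGood hF hh)]
  filter_upwards [hFQ] with t ht
  have hw : Measurable (pairWeight F (h t)) :=
    (measurable_pairWeight hF hh).comp measurable_prodMk_left
  have hoff : ∫⁻ z in {z : C × C | z.1 ≠ z.2}, (1 + F (h t z.1 z.2)) ∂(Q.prod Q) < ∞ := by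
    rw [lintegral_add_left measurable_const]
    refine ENNReal.add_lt_top.2 ⟨?_, ht⟩
    simp [measure_lt_top]
  have hfin : ∫⁻ z, pairWeight F (h t) z ∂(Q.prod Q) ≠ ∞ := by
    simp only [pairWeight]
    rw [lintegral_indicator measurableSet_offDiag]
    exact hoff.ne
  have h1 : ∀ᵐ x ∂Q, ∫⁻ y, pairWeight F (h t) (x, y) ∂Q < ∞ := by
    rw [lintegral_prod _ hw.aemeasurable] at hfin
    exact ae_lt_top (Measurable.lintegral_prod_right (by exact hw)) hfin
  have h2 : ∀ᵐ x ∂Q, ∫⁻ y, pairWeight F (h t) (y, x) ∂Q < ∞ := by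
    rw [lintegral_prod_symm _ hw.aemeasurable] at hfin
    exact ae_lt_top (Measurable.lintegral_prod_left (by exact hw)) hfin
  have h3 : ∀ᵐ c ∂(Measure.pi fun _ : Fin n => Q), ∀ i,
      ∫⁻ y, (pairWeight F (h t) (y, c i) + pairWeight F (h t) (c i, y)) ∂Q < ∞ := by
    rw [ae_all_iff]
    intro i
    have := h1.and h2
    filter_upwards [(Measure.quasiMeasurePreserving_eval (fun _ : Fin n => Q) i).ae this] with c hc
    rw [lintegral_add_left (by fun_prop)]
    exact ENNReal.add_lt_top.2 ⟨hc.2, hc.1⟩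
  have h4 : ∀ᵐ c ∂((Measure.pi fun _ : Fin n => Q)[|{c | Function.Injective c}]),
      Function.Injective c := ae_cond_mem (measurableSet_injective n)
  filter_upwards [h4, cond_absolutelyContinuous.ae_le h3] with c hc1 hc2
  exact ⟨hc1, hoff, hc2⟩

end Posterior

/-! ### Convergence of the posteriors -/

section Convergence

variable {H C X : Type*} [MeasurableSpace H] [MeasurableSpace C] [StandardBorelSpace C]
  [Nonempty C] [MeasurableSpace X] [StandardBorelSpace X] [Nonempty X]
  {Q : Measure C} [IsProbabilityMeasure Q]

/-- Versions of the posteriors that converge for almost all data, when the index of the link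
function lives in a standard Borel space: one regular conditional distribution of the unobserved
quantities serves all `α`, because their law given that the points are distinct is free of `α`. -/
lemma exists_isPosterior_tendsto_of_standardBorel [StandardBorelSpace H] [Nonempty H]
    {n : ℕ} (hn : 2 ≤ n)
    {h : H → C → C → X} (hh : Measurable fun p : H × C × C => h p.1 p.2.1 p.2.2)
    (π : Measure H) [IsProbabilityMeasure π] {DP : ℝ → Measure (ProbabilityMeasure C)}
    (hDP : ∀ α : ℝ, 0 < α → IsDirichletProcess Q α (DP α))
    {T : ProbabilityMeasure X → ℝ} (hT : Measurable T) {F : X → ℝ≥0} (hF : Measurable F)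
    (hFQ : ∀ᵐ t ∂π, ∫⁻ p in {p : C × C | p.1 ≠ p.2}, F (h t p.1 p.2) ∂(Q.prod Q) < ∞) :
    ∃ (post : ℝ → Kernel (DyadicData n X) ℝ) (hpost : ∀ α, IsMarkovKernel (post α)),
      (∀ α : ℝ, 0 < α → IsPosterior h π (DP α) T (post α)) ∧
      ∀ α₀ : ℝ, 0 < α₀ → ∀ᵐ x ∂(dataLaw h π (DP α₀) n), ContinuousAtDraws F T x →
        Tendsto (fun α => kernelAt (post α) (hpost α) x) (𝓝[>] 0) (𝓝 (bootstrapLaw T x)) := by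
  classical
  have hlat := measurable_latentData (n := n) hh
  let κ : Kernel (DyadicData n X) (H × (Fin n → C)) :=
    condDistrib id (latentData h) (latentLaw π Q n)
  have hκ : (latentLaw π Q n).map (latentData h) ⊗ₘ κ =
      (latentLaw π Q n).map fun p => (latentData h p, p) :=
    compProd_map_condDistrib aemeasurable_id
  let post : ℝ → Kernel (DyadicData n X) ℝ := fun α =>
    if 0 < α then thetaKernel T h (drawLaw (DP α) α n) ∘ₖ κ else Kernel.const _ (Measure.dirac 0)
  have hν : ∀ α, 0 < α → IsProbabilityMeasure (drawLaw (DP α) α n) := fun α hα =>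
    have := (hDP α hα).isProbabilityMeasure
    isProbabilityMeasure_drawLaw (DP α) hα n
  have hη : ∀ α, 0 < α → IsMarkovKernel (thetaKernel T h (drawLaw (DP α) α n)) := fun α hα =>
    have := hν α hα
    isMarkovKernel_thetaKernel hT hh _
  have hpost : ∀ α, IsMarkovKernel (post α) := by
    intro α
    by_cases hα : 0 < α
    · have := hη α hα
      simp only [post, if_pos hα]
      infer_instance
    · simp only [post, if_neg hα]
      infer_instance
  refine ⟨post, hpost, fun α hα => ?_, fun α₀ hα₀ => ?_⟩
  · simp only [post, if_pos hα]
    exact (hDP α hα).isPosterior hα hT hh hκ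
  rw [(hDP α₀ hα₀).dataLaw_eq hα₀ n hh]
  -- for almost all data `x`, the conditional law lives on good latent points that produce `x`
  have hgood : ∀ᵐ x ∂((latentLaw π Q n).map (latentData h)), ∀ᵐ p ∂(κ x),
      IsGood Q F h p ∧ latentData h p = x := by
    refine Measure.ae_ae_of_ae_compProd (p := fun q : DyadicData n X × (H × (Fin n → C)) =>
      IsGood Q F h q.2 ∧ latentData h q.2 = q.1) ?_
    have hm : MeasurableSet {q : DyadicData n X × (H × (Fin n → C)) |
        IsGood Q F h q.2 ∧ latentData h q.2 = q.1} :=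
      (measurable_snd (measurableSet_isGood hF hh)).inter
        (measurableSet_eq_fun (hlat.comp measurable_snd) measurable_fst)
    have hpair : Measurable fun p : H × (Fin n → C) => (latentData h p, p) :=
      hlat.prodMk measurable_id
    rw [hκ, ae_map_iff hpair.aemeasurable hm]
    filter_upwards [ae_isGood hF hh n hFQ] with p hp using ⟨hp, rfl⟩
  filter_upwards [hgood] with x hx hcont
  rw [ProbabilityMeasure.tendsto_iff_forall_integral_tendsto]
  intro φ
  have hpos : ∀ᶠ α : ℝ in 𝓝[>] 0, 0 < α := eventually_mem_nhdsWithin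
  have hthetaMeas : ∀ p : H × (Fin n → C),
      Measurable fun ω => T (dyadLaw (h p.1) (postDraw p.2 ω)) := fun p =>
        (measurable_theta_postDraw hT hh).comp measurable_prodMk_left
  have hkey : Tendsto (fun α => ∫ p, ∫ y, φ y ∂(thetaKernel T h (drawLaw (DP α) α n) p) ∂(κ x))
      (𝓝[>] 0) (𝓝 (∫ _, (∫ y, φ y ∂(bootstrapLaw T x : Measure ℝ)) ∂(κ x))) := by
    refine tendsto_integral_filter_of_dominated_convergence (fun _ => ‖φ‖) ?_ ?_
      (integrable_const _) ?_
    · filter_upwards [hpos] with α hα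
      have := hη α hα
      exact (φ.continuous.stronglyMeasurable.integral_kernel).aestronglyMeasurable
    · filter_upwards [hpos] with α hα
      have := hη α hα
      exact Eventually.of_forall fun p => φ.norm_integral_le_norm _
    · filter_upwards [hx] with p hp
      obtain ⟨⟨hinj, hoff, hcross⟩, rfl⟩ := hp
      refine (tendsto_integral_drawLaw hDP (hh.comp measurable_prodMk_left) hT hF hn hinj hoff.ne
        (fun i => (hcross i).ne) hcont φ).congr' ?_
      filter_upwards [hpos] with α hα
      have := hν α hα
      rw [thetaKernel_apply hT hh, integral_map (hthetaMeas p).aemeasurable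
        φ.continuous.measurable.aestronglyMeasurable]
  rw [integral_const, probReal_univ, one_smul] at hkey
  refine hkey.congr' ?_
  filter_upwards [hpos] with α hα
  have := hη α hα
  simp only [kernelAt, ProbabilityMeasure.coe_mk, post, if_pos hα]
  exact (Kernel.integral_comp (φ.integrable _)).symm

/-- The model depends on the law of the index only through its image under a relabelling. -/
lemma IsDirichletProcess.modelLaw_map_index {H' : Type*} [MeasurableSpace H']
    (π : Measure H) [IsProbabilityMeasure π] {φ : H → H'} (hφ : Measurable φ) {α : ℝ}
    {D : Measure (ProbabilityMeasure C)} (hD : IsDirichletProcess Q α D) (hα : 0 < α) (n : ℕ) :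
    modelLaw (π.map φ) D n = (modelLaw π D n).map fun ω => ((φ ω.1.1, ω.1.2), ω.2) := by
  have := hD.isProbabilityMeasure
  have := isProbabilityMeasure_drawLaw D hα n
  have := Measure.isProbabilityMeasure_map (μ := π) hφ.aemeasurable
  have hΦ : Measurable fun ω : (H × ProbabilityMeasure C) × (Fin n → C) =>
      ((φ ω.1.1, ω.1.2), ω.2) := by fun_prop
  have hlat : latentLaw (π.map φ) Q n = (latentLaw π Q n).map (Prod.map φ id) := by
    rw [latentLaw, latentLaw, ← Measure.map_prod_map _ _ hφ measurable_id, Measure.map_id]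
  rw [hD.modelLaw_eq _ hα n, hD.modelLaw_eq _ hα n, hlat, Measure.map_map hΦ measurable_addDraw]
  nth_rw 1 [← Measure.map_id (μ := drawLaw D α n)]
  rw [Measure.map_prod_map _ _ (hφ.prodMap measurable_id) measurable_id,
    Measure.map_map measurable_addDraw ((hφ.prodMap measurable_id).prodMap measurable_id)]
  rfl

/-- Versions of the posteriors that converge for almost all data, with no assumption on the index
space of the link function: the index is replaced by its image in `ℕ → Bool`. -/
lemma exists_isPosterior_tendsto {n : ℕ} (hn : 2 ≤ n)
    {h : H → C → C → X} (hh : Measurable fun p : H × C × C => h p.1 p.2.1 p.2.2)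
    (π : Measure H) [IsProbabilityMeasure π] {DP : ℝ → Measure (ProbabilityMeasure C)}
    (hDP : ∀ α : ℝ, 0 < α → IsDirichletProcess Q α (DP α))
    {T : ProbabilityMeasure X → ℝ} (hT : Measurable T) {F : X → ℝ≥0} (hF : Measurable F)
    (hFQ : ∀ᵐ t ∂π, ∫⁻ p in {p : C × C | p.1 ≠ p.2}, F (h t p.1 p.2) ∂(Q.prod Q) < ∞) :
    ∃ (post : ℝ → Kernel (DyadicData n X) ℝ) (hpost : ∀ α, IsMarkovKernel (post α)),
      (∀ α : ℝ, 0 < α → IsPosterior h π (DP α) T (post α)) ∧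
      ∀ α₀ : ℝ, 0 < α₀ → ∀ᵐ x ∂(dataLaw h π (DP α₀) n), ContinuousAtDraws F T x →
        Tendsto (fun α => kernelAt (post α) (hpost α) x) (𝓝[>] 0) (𝓝 (bootstrapLaw T x)) := by
  obtain ⟨φ, g, hφ, hg, hgh⟩ := exists_factor hh
  obtain rfl : h = fun t c c' => g (φ t, c, c') := by
    funext t c c'
    exact hgh t (c, c')
  let g' : (ℕ → Bool) → C → C → X := fun b c c' => g (b, c, c')
  have hg' : Measurable fun p : (ℕ → Bool) × C × C => g' p.1 p.2.1 p.2.2 := hg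
  have := Measure.isProbabilityMeasure_map (μ := π) hφ.aemeasurable
  have hFQ' : ∀ᵐ b ∂(π.map φ),
      ∫⁻ p in {p : C × C | p.1 ≠ p.2}, F (g' b p.1 p.2) ∂(Q.prod Q) < ∞ := by
    rw [ae_map_iff hφ.aemeasurable]
    · exact hFQ
    · refine measurableSet_lt (Measurable.lintegral_prod_right ?_) measurable_const
      exact (hF.comp hg').coe_nnreal_ennreal
  obtain ⟨post, hpost, hp, hlim⟩ :=
    exists_isPosterior_tendsto_of_standardBorel hn hg' (π.map φ) hDP hT hF hFQ'
  have hΦ : Measurable fun ω : (H × ProbabilityMeasure C) × (Fin n → C) =>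
      ((φ ω.1.1, ω.1.2), ω.2) := by fun_prop
  have hdata := measurable_data (n := n) hg'
  have htheta := measurable_theta (n := n) hT hg'
  have hdl : ∀ α, 0 < α → dataLaw g' (π.map φ) (DP α) n =
      dataLaw (fun t c c' => g (φ t, c, c')) π (DP α) n := by
    intro α hα
    rw [dataLaw, (hDP α hα).modelLaw_map_index π hφ hα n, Measure.map_map hdata hΦ]
    rfl
  refine ⟨post, hpost, fun α hα => ?_, fun α₀ hα₀ => hdl α₀ hα₀ ▸ hlim α₀ hα₀⟩
  have hmap := (hp α hα).map_eq
  have hdl' := hdl α hα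
  rw [dataLaw, dataLaw] at hdl'
  refine ⟨((measurable_data (n := n) hh).prodMk (measurable_theta hT hh)).aemeasurable, ?_⟩
  rw [← hdl', ← hmap, (hDP α hα).modelLaw_map_index π hφ hα n,
    Measure.map_map (hdata.prodMk htheta) hΦ]
  rfl

end Convergence

end DyadicBootstrap

open DyadicBootstrap in
theorem mainTheorem1
    {H C X : Type*} [MeasurableSpace H]
    [MeasurableSpace C] [StandardBorelSpace C]
    [MeasurableSpace X] [StandardBorelSpace X] [Nonempty X]
    (n : ℕ) (hn : 2 ≤ n)
    -- the random link function `h t`, where `t` is drawn from `π`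
    (h : H → C → C → X) (hh : Measurable fun p : H × C × C => h p.1 p.2.1 p.2.2)
    (π : Measure H) [IsProbabilityMeasure π]
    -- the center measure, and the Dirichlet processes `DP(Q, α)` for `α > 0`
    (Q : Measure C) [IsProbabilityMeasure Q]
    (DP : ℝ → Measure (ProbabilityMeasure C))
    (hDP : ∀ α : ℝ, 0 < α → IsDirichletProcess Q α (DP α))
    (T : ProbabilityMeasure X → ℝ) (hT : Measurable T)
    -- the weight of the total variation distance; `F = 0` is always allowed
    (F : X → ℝ≥0) (hF : Measurable F)
    (hFQ : ∀ᵐ t ∂π, ∫⁻ p in {p : C × C | p.1 ≠ p.2}, F (h t p.1 p.2) ∂(Q.prod Q) < ∞) :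
    -- there are versions of the posteriors that converge as `α ↓ 0` for almost all data
    (∃ (post : ℝ → Kernel (DyadicData n X) ℝ) (hpost : ∀ α, IsMarkovKernel (post α)),
      (∀ α : ℝ, 0 < α → IsPosterior h π (DP α) T (post α)) ∧
      ∀ α₀ : ℝ, 0 < α₀ → ∀ᵐ x ∂(dataLaw h π (DP α₀) n), ContinuousAtDraws F T x →
        Tendsto (fun α => kernelAt (post α) (hpost α) x) (𝓝[>] 0)
          (𝓝 (bootstrapLaw T x))) ∧
    -- all versions of the posteriors converge along every sequence `α_m ↓ 0` for almost all data
    (∀ (post : ℝ → Kernel (DyadicData n X) ℝ) (hpost : ∀ α, IsMarkovKernel (post α)),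
      (∀ α : ℝ, 0 < α → IsPosterior h π (DP α) T (post α)) →
      ∀ u : ℕ → ℝ, (∀ m, 0 < u m) → Tendsto u atTop (𝓝 0) →
      ∀ α₀ : ℝ, 0 < α₀ → ∀ᵐ x ∂(dataLaw h π (DP α₀) n), ContinuousAtDraws F T x →
        Tendsto (fun m => kernelAt (post (u m)) (hpost (u m)) x) atTop
          (𝓝 (bootstrapLaw T x))) := by
  have : Nonempty C := nonempty_of_isProbabilityMeasure Q
  obtain ⟨post, hpost, hp, hlim⟩ := exists_isPosterior_tendsto (n := n) hn hh π hDP hT hF hFQ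
  refine ⟨⟨post, hpost, hp, hlim⟩, fun post' hpost' hp' u hu hu0 α₀ hα₀ => ?_⟩
  -- all versions agree almost surely, and the law of the data is the same for all `α`
  have heq : ∀ m, ∀ᵐ x ∂(dataLaw h π (DP α₀) n), post' (u m) x = post (u m) x := by
    intro m
    have hdl := (hDP (u m) (hu m)).dataLaw_eq (π := π) (hu m) n hh
    rw [(hDP α₀ hα₀).dataLaw_eq hα₀ n hh, ← hdl]
    have : IsFiniteMeasure (dataLaw h π (DP (u m)) n) := by
      rw [hdl]
      infer_instance
    refine Kernel.ae_eq_of_compProd_eq ?_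
    rw [dataLaw, ← (hp' _ (hu m)).map_eq, ← (hp _ (hu m)).map_eq]
  have hu0' : Tendsto u atTop (𝓝[>] 0) :=
    tendsto_nhdsWithin_iff.2 ⟨hu0, Eventually.of_forall hu⟩
  filter_upwards [hlim α₀ hα₀, ae_all_iff.2 heq] with x hx hxe hcont
  refine ((hx hcont).comp hu0').congr fun m => ?_
  exact Subtype.ext (hxe m).symm
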